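/- Let $n\ge 1$, $0\le m\le n$, $\frac1n\le p\le\frac12$ and $0<\rho<1$, and put \[ \gamma=\frac{\rho(1-p)}{p},\qquad \phi(\gamma)=(1+\gamma)\log(1+\gamma)-\gamma . \] Let $V_1,V_2$ be two vertex sets of size $n$, and let $\mathcal S_{n,m}$ be the set of injective maps $\pi:S\to V_2$ with $S\subseteq V_1$ and $|S|=m$. For $\pi^*\in\mathcal S_{n,m}$ with domain $S^*$ and range $T^*$, the partially correlated Erdős–Rényi graphs with latent map $\pi^*$ are the following pair of random graphs $G_1$ on $V_1$ and $G_2$ on $V_2$. For each pair $\{u,v\}\subseteq S^*$, the indicators of the edges $uv\in E(G_1)$ and $\pi^*(u)\pi^*(v)\in E(G_2)$ are two Bernoulli variables with mean $p$ and correlation coefficient $\rho$: both are $1$ with probability $p^2+\rho p(1-p)$, exactly one given indicator is $1$ with probability $(1-\rho)p(1-p)$, and both are $0$ with probability $(1-p)^2+\rho p(1-p)$. Every other pair of vertices of $G_1$ (not contained in $S^*$) and of $G_2$ (not contained in $T^*$) is an edge with probability $p$. All of these choices are independent. An estimator $\hat\pi=\hat\pi(G_1,G_2)$ is a function of the two graphs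 whose value is a map from a subset $\hat S\subseteq V_1$ to $V_2$, and \[ \mathrm{overlap}(\pi^*,\hat\pi)=\frac{|\{v\in S^*\cap\hat S:\pi^*(v)=\hat\pi(v)\}|}{|S^*|} \] (which is $0$ if $m=0$). **Possibility.** An estimator $\hat\pi$ that always returns a maximizer over $\pi\in\mathcal S_{n,m}$ of the edge overlap $|\{\{u,v\}\subseteq \mathrm{dom}\,\pi : uv\in E(G_1),\ \pi(u)\pi(v)\in E(G_2)\}|$ exists. For every $\delta\in(0,1)$ there is a constant $c_1(\delta)>0$ such that every such estimator satisfies \[ \mathbb P\big(\mathrm{overlap}(\pi^*,\hat\pi)\ge\delta\big)= 1-o(1)\quad\text{as } n\to\infty, \] uniformly over all $\pi^*\in\mathcal S_{n,m}$ and all $m\le n$, $p\in[\frac1n,\frac12]$, $\rho\in(0,1)$ with $m\ge \dfrac{c_1(\delta)\log n}{p^2\phi(\gamma)}$. **Impossibility.** For all $c,\delta\in(0,1)$ there are a constant $c_2(c,\delta)>0$ and an integer $N(c,\delta)$ such that, for all $n\ge N(c,\delta)$ and all $m\le n$, $p\in[\frac1n,\frac12]$, $\rho\in(0,1)$ with $m\le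 \dfrac{c_2(c,\delta)\log n}{p^2\phi(\gamma)}$, if $\pi^*$ is uniformly distributed over $\mathcal S_{n,m}$, then every estimator $\hat\pi$ satisfies \[ \mathbb P\big(\mathrm{overlap}(\pi^*,\hat\pi)<\delta\big)\ge 1-c . \] -/

import Mathlib

open Finset

noncomputable section

namespace PartialER

/-- A partial map from the vertex set `V(G₁) = Fin n` to the vertex set `V(G₂) = Fin n`;
`π v = none` means that `v` is not in the domain of `π`. -/
abbrev PartialMap (n : ℕ) : Type := Fin n → Option (Fin n)

/-- The domain `S` of a partial map. -/
def PartialMap.dom {n : ℕ} (π : PartialMap n) : Finset (Fin n) :=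
  {v | ∃ w, π v = some w}

/-- The range `T = π(S)` of a partial map. -/
def PartialMap.range {n : ℕ} (π : PartialMap n) : Finset (Fin n) :=
  {w | ∃ v, π v = some w}

/-- The set `𝒮_{n,m}` of the injective maps `π : S → V(G₂)` with `S ⊆ V(G₁)` and `|S| = m`. -/
def injections (n m : ℕ) : Finset (PartialMap n) :=
  {π | #π.dom = m ∧ ∀ u v w, π u = some w → π v = some w → u = v}

/-- `overlap π π' = |{v ∈ S ∩ S' : π v = π' v}| / |S|`, where `S`, `S'` are the domains of `π` and
`π'`. (It is `0` if `S` is empty.) -/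
def overlap {n : ℕ} (π π' : PartialMap n) : ℝ :=
  (#{v : Fin n | ∃ w, π v = some w ∧ π' v = some w} : ℝ) / #π.dom

/-- The unordered pairs of distinct vertices, each written with the smaller vertex first. -/
def pairs (n : ℕ) : Finset (Fin n × Fin n) :=
  {e | e.1 < e.2}

/-- `π(u)π(v)` is an edge of `G`, where `u` and `v` are in the domain of `π`. -/
def ImageAdj {n : ℕ} (π : PartialMap n) (G : SimpleGraph (Fin n)) (u v : Fin n) : Prop :=
  ∃ a b, π u = some a ∧ π v = some b ∧ G.Adj a b

open Classical in
/-- The mass function of the Bernoulli distribution with mean `p`; `a` is the event "the value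
is `1`". -/
def bern (p : ℝ) (a : Prop) : ℝ :=
  if a then p else 1 - p

open Classical in
/-- The mass function of `Bern(p, p, ρ)`, the law of two Bernoulli variables with mean `p` and
correlation coefficient `ρ`. -/
def bernPair (p ρ : ℝ) (a b : Prop) : ℝ :=
  if a then
    if b then p ^ 2 + ρ * p * (1 - p) else (1 - ρ) * p * (1 - p)
  else
    if b then (1 - ρ) * p * (1 - p) else (1 - p) ^ 2 + ρ * p * (1 - p)

/-- The joint mass function of the partially correlated Erdős–Rényi graphs `(G₁, G₂)` with latent
injection `π`: for the pairs `uv` inside the domain of `π`, the two indicators of `uv ∈ E(G₁)` and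
`π(u)π(v) ∈ E(G₂)` follow `Bern(p, p, ρ)`; each other pair of vertices of `G₁` and of `G₂` is an
edge with probability `p`; and all of these are independent. -/
def mass {n : ℕ} (p ρ : ℝ) (π : PartialMap n) (G₁ G₂ : SimpleGraph (Fin n)) : ℝ :=
  (∏ e ∈ pairs n with e.1 ∈ π.dom ∧ e.2 ∈ π.dom,
      bernPair p ρ (G₁.Adj e.1 e.2) (ImageAdj π G₂ e.1 e.2)) *
    (∏ e ∈ pairs n with ¬(e.1 ∈ π.dom ∧ e.2 ∈ π.dom), bern p (G₁.Adj e.1 e.2)) *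
    (∏ e ∈ pairs n with ¬(e.1 ∈ π.range ∧ e.2 ∈ π.range), bern p (G₂.Adj e.1 e.2))

open Classical in
/-- The probability of the event `A` about the graphs `(G₁, G₂)`, given the latent injection `π`. -/
def prob {n : ℕ} (p ρ : ℝ) (π : PartialMap n)
    (A : SimpleGraph (Fin n) → SimpleGraph (Fin n) → Prop) : ℝ :=
  ∑ G₁ : SimpleGraph (Fin n), ∑ G₂ : SimpleGraph (Fin n),
    if A G₁ G₂ then mass p ρ π G₁ G₂ else 0

/-- The probability of the event `A` about the latent injection and the graphs, when the latent
injection is uniformly distributed over `𝒮_{n,m}`. -/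
def bayesProb (n m : ℕ) (p ρ : ℝ)
    (A : PartialMap n → SimpleGraph (Fin n) → SimpleGraph (Fin n) → Prop) : ℝ :=
  (∑ π ∈ injections n m, prob p ρ π (A π)) / #(injections n m)

/-- An estimator: a function of the two observed graphs whose value is a partial map, with no
restriction on its domain. -/
abbrev Estimator (n : ℕ) : Type :=
  SimpleGraph (Fin n) → SimpleGraph (Fin n) → PartialMap n

open Classical in
/-- The edge overlap `∑ β_{uv}(G₁) β_{π(u)π(v)}(G₂)` over the pairs `uv` in the domain of `π`. -/
def edgeOverlap {n : ℕ} (π : PartialMap n) (G₁ G₂ : SimpleGraph (Fin n)) : ℕ :=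
  #{e ∈ pairs n | G₁.Adj e.1 e.2 ∧ ImageAdj π G₂ e.1 e.2}

/-- The estimator always returns a maximizer of the edge overlap over `𝒮_{n,m}`. -/
def MaximizesEdgeOverlap {n : ℕ} (m : ℕ) (est : Estimator n) : Prop :=
  ∀ G₁ G₂ : SimpleGraph (Fin n), est G₁ G₂ ∈ injections n m ∧
    ∀ π ∈ injections n m, edgeOverlap π G₁ G₂ ≤ edgeOverlap (est G₁ G₂) G₁ G₂

/-- The relative signal strength `γ = ρ (1 - p) / p`. -/
def signal (p ρ : ℝ) : ℝ := ρ * (1 - p) / p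

/-- `φ(γ) = (1 + γ) log (1 + γ) - γ`. -/
def phi (γ : ℝ) : ℝ := (1 + γ) * Real.log (1 + γ) - γ

end PartialER

end

/-! Extending the latent map to a permutation `τ₀` and relabelling `G₂` along it makes the two
graphs a family of independent pairs of indicators, one pair per edge, correlated only inside `S₀`
(`prob_restrict`). What remains is a study of product laws.

Possibility. Let `π` have overlap below `δ`, with agreement set `F`. Edges inside `F` count equally
for `π` and the latent map, so `π` can win only if its spurious hits outside `F` are at least as
many as the true ones. Both sums have the same number `N` of terms, of order `(1 - δ) m²` at least,
and are compared with `N p² (1 + γ / 2)`. The true count depends on `F` alone, so its lower tail is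
paid for at most `2 ^ m` sets; its exponent `N p² γ² / (1 + γ)` may be smaller than `N p² φ(γ)` by a
factor `log n`, which is affordable there (`phi_signal_le`). The upper tail of the spurious count
must beat all `n ^ (2m)` maps. Its terms are dependent along orbits of an edge permutation, but each
coordinate enters at most two of them, so Finner's inequality (`prodExp_prod_le_prod_sqrt`)
decouples them at the price of doubling the exponential parameter.

Impossibility. The law is compared with that at `ρ = 0`, where the graphs say nothing about `π`,
through `x P(A) ≤ KL(P, Q) + exp x * Q(A)`. The relative entropy is at most `13 m² p² φ(γ)`, and any
fixed guess is good for at most a fraction `exp (-x)` of the injections when `x = (δ / 4) m log n`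
(`card_overlap_le`). Averaged over `π`, the success probability is at most `(13 m² p² φ(γ) + 1) /
x`. -/

noncomputable section

namespace PartialER

/-! ### Product expectations and Finner's inequality. -/

section ProductExpectation

variable {ι α J : Type*} [Fintype ι] [DecidableEq ι] [Fintype α]

/-- The expectation of `F` under the product of the weights `w i`. -/
def prodExp (w : ι → α → ℝ) (F : (ι → α) → ℝ) : ℝ :=
  ∑ z : ι → α, (∏ i, w i (z i)) * F z

theorem prodExp_prod (w g : ι → α → ℝ) :
    prodExp w (fun z => ∏ i, g i (z i)) = ∏ i, ∑ a, w i a * g i a := by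
  classical
  simp only [prodExp, ← prod_mul_distrib]
  rw [Finset.prod_univ_sum]
  simp

theorem prodExp_one {w : ι → α → ℝ} (hw : ∀ i, ∑ a, w i a = 1) :
    prodExp w (fun _ => 1) = 1 := by
  have h := prodExp_prod w (fun _ _ => 1)
  simpa [hw] using h

theorem prodExp_mono {w : ι → α → ℝ} (hw : ∀ i a, 0 ≤ w i a) {F G : (ι → α) → ℝ}
    (h : ∀ z, F z ≤ G z) : prodExp w F ≤ prodExp w G :=
  sum_le_sum fun z _ => mul_le_mul_of_nonneg_left (h z) (prod_nonneg fun i _ => hw i _)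

theorem prodExp_add (w : ι → α → ℝ) (F G : (ι → α) → ℝ) :
    prodExp w (fun z => F z + G z) = prodExp w F + prodExp w G := by
  simp [prodExp, mul_add, sum_add_distrib]

theorem prodExp_const_mul (w : ι → α → ℝ) (c : ℝ) (F : (ι → α) → ℝ) :
    prodExp w (fun z => c * F z) = c * prodExp w F := by
  simp only [prodExp, mul_sum]
  exact sum_congr rfl fun z _ => by ring

theorem prodExp_sum (w : ι → α → ℝ) (s : Finset J) (F : J → (ι → α) → ℝ) :
    prodExp w (fun z => ∑ j ∈ s, F j z) = ∑ j ∈ s, prodExp w (F j) := by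
  simp only [prodExp, mul_sum]
  exact sum_comm

theorem prodExp_coord {w : ι → α → ℝ} (hw : ∀ i, ∑ a, w i a = 1) (i : ι) (f : α → ℝ) :
    prodExp w (fun z => f (z i)) = ∑ a, w i a * f a := by
  have h := prodExp_prod w (fun j a => if j = i then f a else 1)
  simp only [prod_ite_eq', mem_univ, if_true] at h
  rw [h, prod_eq_single i]
  · simp
  · intro j _ hj
    simp [hj, hw]
  · simp

theorem prodExp_coord_mul {w : ι → α → ℝ} (hw : ∀ i, ∑ a, w i a = 1) {i j : ι} (hij : i ≠ j)
    (f g : α → ℝ) :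
    prodExp w (fun z => f (z i) * g (z j)) = (∑ a, w i a * f a) * ∑ a, w j a * g a := by
  have h := prodExp_prod w
    (fun k a => (if k = i then f a else 1) * (if k = j then g a else 1))
  simp only [prod_mul_distrib, prod_ite_eq', mem_univ, if_true] at h
  rw [h, ← mul_prod_erase univ _ (mem_univ i),
    ← mul_prod_erase (univ.erase i) _ (mem_erase.2 ⟨hij.symm, mem_univ j⟩), prod_eq_one]
  · simp [hij, hij.symm]
  · intro k hk
    simp only [mem_erase, mem_univ, and_true] at hk
    simp [hk.1, hk.2, hw]

/-- The one-coordinate case of Finner's inequality: Cauchy–Schwarz handles the factors in `B`, and a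
factor constant in `a` equals its own L² norm because the weights sum to one. -/
theorem sum_mul_prod_le_prod_sqrt [Fintype J] {w : α → ℝ} (hw0 : ∀ a, 0 ≤ w a)
    (hw : ∑ a, w a = 1) {f : J → α → ℝ} (hf : ∀ j a, 0 ≤ f j a) (B : Finset J)
    (hB : #B ≤ 2) (hc : ∀ j ∉ B, ∀ a b, f j a = f j b) :
    ∑ a, w a * ∏ j, f j a ≤ ∏ j, √(∑ a, w a * f j a ^ 2) := by
  classical
  have hne : Nonempty α := by
    by_contra h
    rw [not_nonempty_iff] at h
    simp at hw
  obtain ⟨a₀⟩ := hne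
  have hcs : ∀ g h : α → ℝ,
      ∑ a, w a * (g a * h a) ≤ √(∑ a, w a * g a ^ 2) * √(∑ a, w a * h a ^ 2) := by
    intro g h
    have := Real.sum_mul_le_sqrt_mul_sqrt univ (fun a => √(w a) * g a) (fun a => √(w a) * h a)
    refine le_trans (le_of_eq ?_) (this.trans (le_of_eq ?_))
    · refine sum_congr rfl fun a _ => ?_
      rw [mul_mul_mul_comm, Real.mul_self_sqrt (hw0 a)]
    · simp only [mul_pow, Real.sq_sqrt (hw0 _)]
  have key : ∑ a, w a * ∏ j ∈ B, f j a ≤ ∏ j ∈ B, √(∑ a, w a * f j a ^ 2) := by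
    have h3 : #B = 0 ∨ #B = 1 ∨ #B = 2 := by omega
    rcases h3 with h | h | h
    · rw [card_eq_zero] at h
      simp [h, hw]
    · obtain ⟨j, rfl⟩ := card_eq_one.1 h
      simpa [hw] using hcs (f j) (fun _ => 1)
    · obtain ⟨i, j, hij, rfl⟩ := card_eq_two.1 h
      simpa [prod_pair hij] using hcs (f i) (f j)
  have hrest : ∀ a, ∏ j ∈ Bᶜ, f j a = ∏ j ∈ Bᶜ, √(∑ a, w a * f j a ^ 2) := by
    intro a
    refine prod_congr rfl fun j hj => ?_
    have : ∑ b, w b * f j b ^ 2 = f j a ^ 2 := by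
      rw [← one_mul (f j a ^ 2), ← hw, sum_mul]
      exact sum_congr rfl fun b _ => by rw [hc j (mem_compl.1 hj) b a]
    rw [this, Real.sqrt_sq (hf j a)]
  rw [← prod_mul_prod_compl B (fun j => √(∑ a, w a * f j a ^ 2))]
  calc ∑ a, w a * ∏ j, f j a
      = ∑ a, (w a * ∏ j ∈ B, f j a) * ∏ j ∈ Bᶜ, √(∑ a, w a * f j a ^ 2) := by
        refine sum_congr rfl fun a _ => ?_
        rw [← prod_mul_prod_compl B, hrest a, mul_assoc]
    _ ≤ _ := by
        rw [← sum_mul]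
        exact mul_le_mul_of_nonneg_right key (prod_nonneg fun j _ => Real.sqrt_nonneg _)

end ProductExpectation

theorem prodExp_equiv {ι κ α : Type*} [Fintype ι] [DecidableEq ι] [Fintype κ] [DecidableEq κ]
    [Fintype α] (e : ι ≃ κ) (w : κ → α → ℝ) (F : (κ → α) → ℝ) :
    prodExp w F = prodExp (fun i => w (e i)) (fun z => F (fun k => z (e.symm k))) := by
  unfold prodExp
  rw [← Equiv.sum_comp (Equiv.arrowCongr e (Equiv.refl α))]
  refine sum_congr rfl fun z _ => ?_
  congr 1
  rw [← Equiv.prod_comp e]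
  simp

theorem prodExp_option {ι α : Type*} [Fintype ι] [DecidableEq ι] [DecidableEq (Option ι)]
    [Fintype α]
    (w : Option ι → α → ℝ) (F : (Option ι → α) → ℝ) :
    prodExp w F = prodExp (fun i => w (some i))
      (fun z => ∑ a, w none a * F (fun o => o.elim a z)) := by
  unfold prodExp
  rw [← Equiv.sum_comp (Equiv.piOptionEquivProd (α := ι) (β := fun _ => α)).symm,
    Fintype.sum_prod_type_right]
  refine sum_congr rfl fun z _ => ?_
  rw [mul_sum]
  refine sum_congr rfl fun a _ => ?_
  have : (Equiv.piOptionEquivProd (α := ι) (β := fun _ => α)).symm (a, z)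
      = fun o : Option ι => o.elim a z := by
    funext o; cases o <;> rfl
  rw [this, Fintype.prod_option]
  simp only [Option.elim_none, Option.elim_some]
  ring

/-- Finner's inequality for factors in which every coordinate occurs at most twice. -/
theorem prodExp_prod_le_prod_sqrt {J : Type*} [Fintype J] [DecidableEq J]
    {α : Type*} [Fintype α] {ι : Type*} [Fintype ι] [DecidableEq ι]
    (w : ι → α → ℝ) (hw0 : ∀ i a, 0 ≤ w i a) (hw : ∀ i, ∑ a, w i a = 1)
    (D : ι → J → Prop) (F : J → (ι → α) → ℝ) (hF : ∀ j z, 0 ≤ F j z)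
    (hD : ∀ j z z', (∀ i, D i j → z i = z' i) → F j z = F j z')
    (h2 : ∀ i, ∃ B : Finset J, #B ≤ 2 ∧ ∀ j, D i j → j ∈ B) :
    prodExp w (fun z => ∏ j, F j z) ≤ ∏ j, √(prodExp w (fun z => F j z ^ 2)) := by
  classical
  revert w D F
  refine Fintype.induction_empty_option (P := fun ι _ => ∀ [DecidableEq ι] (w : ι → α → ℝ),
    (∀ i a, 0 ≤ w i a) → (∀ i, ∑ a, w i a = 1) → ∀ (D : ι → J → Prop) (F : J → (ι → α) → ℝ),
    (∀ j z, 0 ≤ F j z) → (∀ j z z', (∀ i, D i j → z i = z' i) → F j z = F j z') →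
    (∀ i, ∃ B : Finset J, #B ≤ 2 ∧ ∀ j, D i j → j ∈ B) →
    prodExp w (fun z => ∏ j, F j z) ≤ ∏ j, √(prodExp w (fun z => F j z ^ 2))) ?_ ?_ ?_ ι
  · intro κ ι _ e ih _ w hw0 hw D F hF hD h2
    let _ : Fintype κ := Fintype.ofEquiv ι e.symm
    let _ : DecidableEq κ := Classical.decEq κ
    rw [prodExp_equiv e]
    simp only [fun j => prodExp_equiv e w (fun z => F j z ^ 2)]
    refine ih (fun i => w (e i)) (fun i => hw0 _) (fun i => hw _) (fun i => D (e i))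
      (fun j z => F j (fun k => z (e.symm k))) (fun j z => hF _ _) (fun j z z' h => ?_)
      (fun i => h2 _)
    refine hD _ _ _ fun i hi => h _ ?_
    simpa using hi
  · intro _ w _ _ D F hF hD _
    simp only [prodExp, univ_eq_empty, prod_empty, one_mul, univ_unique, sum_singleton]
    exact prod_le_prod (fun j _ => hF _ _) fun j _ => (Real.sqrt_sq (hF _ _)).ge
  -- The coordinate `none` is integrated out: each factor becomes its L² norm in that coordinate,
  -- which depends on the same remaining coordinates as before, so the induction hypothesis applies.
  · intro ι _ ih _ w hw0 hw D F hF hD h2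
    let _ : DecidableEq ι := Classical.decEq ι
    rw [prodExp_option]
    simp only [fun j => prodExp_option w (fun z => F j z ^ 2)]
    have hstep : ∀ z : ι → α, ∑ a, w none a * ∏ j, F j (fun o => o.elim a z) ≤
        ∏ j, √(∑ a, w none a * F j (fun o => o.elim a z) ^ 2) := by
      intro z
      obtain ⟨B, hB, hDB⟩ := h2 none
      refine sum_mul_prod_le_prod_sqrt (hw0 none) (hw none) (fun j a => hF _ _) B hB ?_
      intro j hj a b
      refine hD _ _ _ fun i hi => ?_
      cases i with
      | none => exact absurd (hDB j hi) hj
      | some i => rfl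
    refine (prodExp_mono (fun i => hw0 _) hstep).trans ?_
    have := ih (fun i => w (some i)) (fun i => hw0 _) (fun i => hw _) (fun i => D (some i))
      (fun j z => √(∑ a, w none a * F j (fun o => o.elim a z) ^ 2))
      (fun j z => Real.sqrt_nonneg _) (fun j z z' h => ?_) (fun i => h2 _)
    · refine this.trans (le_of_eq ?_)
      refine prod_congr rfl fun j _ => ?_
      congr 2
      funext z
      exact Real.sq_sqrt (sum_nonneg fun a _ => mul_nonneg (hw0 _ _) (sq_nonneg _))
    · congr 1
      refine sum_congr rfl fun a _ => ?_
      rw [hD j (fun o => o.elim a z) (fun o => o.elim a z')]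
      intro i hi
      cases i with
      | none => rfl
      | some i => exact h i hi

/-! ### Edges and the action of vertex permutations on them. -/

/-- The unordered pairs of distinct vertices, as a type. -/
abbrev Edge (n : ℕ) : Type := {e : Fin n × Fin n // e ∈ pairs n}

section Edges

variable {n : ℕ}

theorem Edge.lt (e : Edge n) : e.1.1 < e.1.2 := by
  have := e.2
  simpa [pairs] using this

/-- The unordered pair formed by two distinct vertices. -/
def mkEdge (u v : Fin n) (h : u ≠ v) : Edge n :=
  if huv : u < v then ⟨(u, v), by simpa [pairs] using huv⟩
  else ⟨(v, u), by simpa [pairs] using lt_of_le_of_ne (not_lt.1 huv) h.symm⟩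

theorem mkEdge_comm (u v : Fin n) (h : u ≠ v) : mkEdge v u h.symm = mkEdge u v h := by
  unfold mkEdge
  rcases lt_or_gt_of_ne h with h1 | h1
  · simp [h1, h1.not_gt]
  · simp [h1, h1.not_gt]

theorem mkEdge_self (e : Edge n) : mkEdge e.1.1 e.1.2 e.lt.ne = e := by
  simp [mkEdge, e.lt]

theorem mkEdge_fst_snd (u v : Fin n) (h : u ≠ v) :
    ((mkEdge u v h).1.1 = u ∧ (mkEdge u v h).1.2 = v) ∨
      ((mkEdge u v h).1.1 = v ∧ (mkEdge u v h).1.2 = u) := by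
  unfold mkEdge
  split_ifs <;> simp

/-- The graph with the given edge indicators. -/
def toGraph (x : Edge n → Prop) : SimpleGraph (Fin n) where
  Adj u v := ∃ h : u ≠ v, x (mkEdge u v h)
  symm := ⟨fun u v ⟨h, hx⟩ => ⟨h.symm, by rwa [mkEdge_comm u v h]⟩⟩
  loopless := ⟨fun u ⟨h, _⟩ => h rfl⟩

theorem toGraph_adj_edge (x : Edge n → Prop) (e : Edge n) :
    (toGraph x).Adj e.1.1 e.1.2 ↔ x e :=
  ⟨fun ⟨_, hx⟩ => by rwa [mkEdge_self] at hx, fun hx => ⟨e.lt.ne, by rwa [mkEdge_self]⟩⟩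

theorem adj_mkEdge (G : SimpleGraph (Fin n)) (u v : Fin n) (h : u ≠ v) :
    G.Adj (mkEdge u v h).1.1 (mkEdge u v h).1.2 ↔ G.Adj u v := by
  rcases mkEdge_fst_snd u v h with ⟨h1, h2⟩ | ⟨h1, h2⟩
  · rw [h1, h2]
  · rw [h1, h2, G.adj_comm]

/-- Graphs correspond to their edge indicators. -/
def graphEquiv (n : ℕ) : (Edge n → Prop) ≃ SimpleGraph (Fin n) where
  toFun := toGraph
  invFun G e := G.Adj e.1.1 e.1.2
  left_inv x := funext fun e => propext (toGraph_adj_edge x e)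
  right_inv G := by
    ext u v
    exact ⟨fun ⟨h, hx⟩ => (adj_mkEdge G u v h).1 hx,
      fun h => ⟨h.ne, (adj_mkEdge G u v h.ne).2 h⟩⟩

/-- The action of a permutation of the vertices on the edges. -/
def edgeMap (τ : Equiv.Perm (Fin n)) (e : Edge n) : Edge n :=
  mkEdge (τ e.1.1) (τ e.1.2) (τ.injective.ne e.lt.ne)

theorem adj_edgeMap (G : SimpleGraph (Fin n)) (τ : Equiv.Perm (Fin n)) (e : Edge n) :
    G.Adj (edgeMap τ e).1.1 (edgeMap τ e).1.2 ↔ G.Adj (τ e.1.1) (τ e.1.2) :=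
  adj_mkEdge G _ _ _

theorem edgeMap_symm_edgeMap (τ : Equiv.Perm (Fin n)) (e : Edge n) :
    edgeMap τ.symm (edgeMap τ e) = e := by
  have hlt := e.lt
  have h : ∀ u v (h : u ≠ v) (a b : Fin n), a < b → (u = τ a ∧ v = τ b ∨ u = τ b ∧ v = τ a) →
      (mkEdge (τ.symm u) (τ.symm v) (τ.symm.injective.ne h)).1 = (a, b) := by
    rintro u v h a b hab (⟨rfl, rfl⟩ | ⟨rfl, rfl⟩)
    · simp [mkEdge, hab]
    · simp [mkEdge, hab.not_gt]
  refine Subtype.ext (h _ _ (edgeMap τ e).lt.ne _ _ e.lt ?_)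
  rcases mkEdge_fst_snd (τ e.1.1) (τ e.1.2) (τ.injective.ne e.lt.ne) with h | h
  · exact Or.inl h
  · exact Or.inr h

theorem edgeMap_injective (τ : Equiv.Perm (Fin n)) : Function.Injective (edgeMap τ) :=
  Function.LeftInverse.injective (edgeMap_symm_edgeMap τ)

/-- Serves to index the pairs of `G₂` by those of `G₁`; the symmetry of `g` absorbs a reversal of
the endpoints. -/
theorem prod_edge_perm (τ : Equiv.Perm (Fin n)) (g : Fin n → Fin n → ℝ)
    (hg : ∀ u v, g u v = g v u) :
    ∏ e : Edge n, g (τ e.1.1) (τ e.1.2) = ∏ e : Edge n, g e.1.1 e.1.2 := by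
  have hb : Function.Bijective (edgeMap τ) := Finite.injective_iff_bijective.1 (edgeMap_injective τ)
  rw [← hb.prod_comp (fun e => g e.1.1 e.1.2)]
  refine prod_congr rfl fun e _ => ?_
  rcases mkEdge_fst_snd (τ e.1.1) (τ e.1.2) (τ.injective.ne e.lt.ne) with ⟨h1, h2⟩ | ⟨h1, h2⟩
  · rw [edgeMap, h1, h2]
  · rw [edgeMap, h1, h2, hg]

theorem prod_pairs_filter (P : Fin n → Fin n → Prop) [DecidableRel P]
    (f : Fin n → Fin n → ℝ) :
    ∏ e ∈ pairs n with P e.1 e.2, f e.1 e.2 =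
      ∏ e : Edge n, if P e.1.1 e.1.2 then f e.1.1 e.1.2 else 1 := by
  rw [prod_filter, ← prod_coe_sort (pairs n) (fun e => if P e.1 e.2 then f e.1 e.2 else 1)]

/-- The edges inside a vertex set. -/
def edgesIn (S : Finset (Fin n)) : Finset (Edge n) :=
  {e | e.1.1 ∈ S ∧ e.1.2 ∈ S}

theorem mem_edgesIn {S : Finset (Fin n)} {e : Edge n} :
    e ∈ edgesIn S ↔ e.1.1 ∈ S ∧ e.1.2 ∈ S := by
  simp [edgesIn]

theorem edgesIn_mono {S T : Finset (Fin n)} (h : S ⊆ T) : edgesIn S ⊆ edgesIn T := fun e he => by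
  rw [mem_edgesIn] at *
  exact ⟨h he.1, h he.2⟩

theorem two_mul_card_edgesIn (S : Finset (Fin n)) : 2 * #(edgesIn S) = #S * (#S - 1) := by
  have h1 : #(edgesIn S) = #(S.offDiag.filter fun e => e.1 < e.2) := by
    refine card_bij (fun e _ => e.1) ?_ ?_ ?_
    · intro e he
      rw [mem_edgesIn] at he
      simp [he, e.lt, e.lt.ne]
    · intro a _ b _ h
      exact Subtype.ext h
    · intro e he
      simp only [mem_filter, mem_offDiag] at he
      exact ⟨⟨e, by simpa [pairs] using he.2⟩, by rw [mem_edgesIn]; exact ⟨he.1.1, he.1.2.1⟩, rfl⟩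
  have h2 : #(S.offDiag.filter fun e => e.1 < e.2) = #(S.offDiag.filter fun e => ¬ e.1 < e.2) := by
    refine card_bij (fun e _ => (e.2, e.1)) ?_ ?_ ?_
    · intro e he
      simp only [mem_filter, mem_offDiag] at he ⊢
      exact ⟨⟨he.1.2.1, he.1.1, he.1.2.2.symm⟩, he.2.not_gt⟩
    · rintro ⟨a, b⟩ _ ⟨c, d⟩ _ h
      simp only [Prod.mk.injEq] at h ⊢
      exact ⟨h.2, h.1⟩
    · intro e he
      simp only [mem_filter, mem_offDiag] at he
      refine ⟨(e.2, e.1), ?_, rfl⟩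
      simp only [mem_filter, mem_offDiag]
      exact ⟨⟨he.1.2.1, he.1.1, he.1.2.2.symm⟩, lt_of_le_of_ne (not_lt.1 he.2) he.1.2.2.symm⟩
  have h3 := card_filter_add_card_filter_not (s := S.offDiag) (fun e => e.1 < e.2)
  rw [offDiag_card] at h3
  rw [Nat.mul_sub, mul_one]
  omega

end Edges

/-! ### Injections as restrictions of permutations. -/

section Injections

variable {n m : ℕ}

theorem PartialMap.mem_dom {π : PartialMap n} {v : Fin n} : v ∈ π.dom ↔ ∃ w, π v = some w := by
  simp [PartialMap.dom]

theorem PartialMap.mem_range {π : PartialMap n} {w : Fin n} : w ∈ π.range ↔ ∃ v, π v = some w := by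
  simp [PartialMap.range]

theorem mem_injections {π : PartialMap n} : π ∈ injections n m ↔
    #π.dom = m ∧ ∀ u v w, π u = some w → π v = some w → u = v := by
  simp [injections]

/-- Every injective partial map is a restriction of a permutation. -/
theorem exists_perm_of_mem_injections {π : PartialMap n} (hπ : π ∈ injections n m) :
    ∃ τ : Equiv.Perm (Fin n), ∀ v ∈ π.dom, π v = some (τ v) := by
  rw [mem_injections] at hπ
  have hinj : Set.InjOn (fun v => (π v).getD v) π.dom := by
    intro u hu v hv huv
    obtain ⟨a, ha⟩ := PartialMap.mem_dom.1 hu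
    obtain ⟨b, hb⟩ := PartialMap.mem_dom.1 hv
    simp only [ha, hb, Option.getD_some] at huv
    subst huv
    exact hπ.2 u v a ha hb
  obtain ⟨g, hg⟩ := Finset.exists_equiv_extend_of_card_eq (t := univ) (by simp)
    (subset_univ _) hinj
  refine ⟨g.trans (Equiv.subtypeUnivEquiv (by simp)), fun v hv => ?_⟩
  obtain ⟨a, ha⟩ := PartialMap.mem_dom.1 hv
  have := hg v hv
  simp [ha] at this
  simp [ha, this]

/-- The restriction of a permutation to a vertex set. -/
def restrict (τ : Equiv.Perm (Fin n)) (S : Finset (Fin n)) : PartialMap n :=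
  fun v => if v ∈ S then some (τ v) else none

theorem dom_restrict (τ : Equiv.Perm (Fin n)) (S : Finset (Fin n)) : (restrict τ S).dom = S := by
  ext v
  simp [PartialMap.mem_dom, restrict]

theorem restrict_eq_some {τ : Equiv.Perm (Fin n)} {S : Finset (Fin n)} {v w : Fin n} :
    restrict τ S v = some w ↔ v ∈ S ∧ τ v = w := by
  simp [restrict]

theorem mem_range_restrict {τ : Equiv.Perm (Fin n)} {S : Finset (Fin n)} {v : Fin n} :
    τ v ∈ (restrict τ S).range ↔ v ∈ S := by
  simp [PartialMap.mem_range, restrict_eq_some]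

theorem restrict_mem_injections (τ : Equiv.Perm (Fin n)) (S : Finset (Fin n)) :
    restrict τ S ∈ injections n #S := by
  rw [mem_injections, dom_restrict]
  refine ⟨rfl, fun u v w hu hv => ?_⟩
  rw [restrict_eq_some] at hu hv
  exact τ.injective (hu.2.trans hv.2.symm)

theorem exists_restrict_eq {π : PartialMap n} (hπ : π ∈ injections n m) :
    ∃ (τ : Equiv.Perm (Fin n)) (S : Finset (Fin n)), #S = m ∧ restrict τ S = π := by
  obtain ⟨τ, hτ⟩ := exists_perm_of_mem_injections hπ
  refine ⟨τ, π.dom, (mem_injections.1 hπ).1, ?_⟩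
  funext v
  unfold restrict
  split_ifs with h
  · exact (hτ v h).symm
  · rw [PartialMap.mem_dom] at h
    cases hv : π v with
    | none => rfl
    | some w => exact absurd ⟨w, hv⟩ h

theorem injections_nonempty (h : m ≤ n) : (injections n m).Nonempty := by
  obtain ⟨S, -, hS⟩ := exists_subset_card_eq (s := (univ : Finset (Fin n))) (n := m) (by simpa)
  exact ⟨_, hS ▸ restrict_mem_injections 1 S⟩

theorem imageAdj_restrict {τ : Equiv.Perm (Fin n)} {S : Finset (Fin n)} {G : SimpleGraph (Fin n)}
    {u v : Fin n} :
    ImageAdj (restrict τ S) G u v ↔ (u ∈ S ∧ v ∈ S) ∧ G.Adj (τ u) (τ v) := by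
  simp only [ImageAdj, restrict_eq_some]
  constructor
  · rintro ⟨a, b, ⟨hu, rfl⟩, ⟨hv, rfl⟩, h⟩
    exact ⟨⟨hu, hv⟩, h⟩
  · rintro ⟨⟨hu, hv⟩, h⟩
    exact ⟨_, _, ⟨hu, rfl⟩, ⟨hv, rfl⟩, h⟩

end Injections

/-! ### The joint law as a product over edges. -/

section Mass

variable {n : ℕ}

theorem bernPair_zero (p : ℝ) (a b : Prop) : bernPair p 0 a b = bern p a * bern p b := by
  unfold bernPair bern
  split_ifs <;> ring

open Classical in
/-- The correlation coefficient of the two indicators at an edge. -/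
def edgeCorr (ρ : ℝ) (S : Finset (Fin n)) (e : Edge n) : ℝ :=
  if e ∈ edgesIn S then ρ else 0

/-- The law of the two indicators at an edge. -/
def edgeLaw (p ρ : ℝ) (S : Finset (Fin n)) (e : Edge n) (a : Prop × Prop) : ℝ :=
  bernPair p (edgeCorr ρ S e) a.1 a.2

/-- The second graph, with its vertices relabelled by `τ`. -/
def relabel (τ : Equiv.Perm (Fin n)) (y : Edge n → Prop) : SimpleGraph (Fin n) :=
  (toGraph y).comap τ.symm

theorem relabel_adj (τ : Equiv.Perm (Fin n)) (y : Edge n → Prop) (u v : Fin n) :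
    (relabel τ y).Adj u v ↔ (toGraph y).Adj (τ.symm u) (τ.symm v) := Iff.rfl

/-- Pulling the pairs of `G₂` back along `τ` puts the three products on one index set; outside `S`
the factors of the two graphs merge into a `bernPair` with zero correlation. -/
theorem mass_restrict (p ρ : ℝ) (τ : Equiv.Perm (Fin n)) (S : Finset (Fin n))
    (z : Edge n → Prop × Prop) :
    mass p ρ (restrict τ S) (toGraph fun e => (z e).1) (relabel τ fun e => (z e).2) =
      ∏ e, edgeLaw p ρ S e (z e) := by
  classical
  unfold mass
  rw [dom_restrict]
  rw [prod_pairs_filter (fun u v => u ∈ S ∧ v ∈ S) (fun u v => bernPair p ρ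
      ((toGraph fun e => (z e).1).Adj u v)
      (ImageAdj (restrict τ S) (relabel τ fun e => (z e).2) u v)),
    prod_pairs_filter (fun u v => ¬(u ∈ S ∧ v ∈ S)) (fun u v => bern p
      ((toGraph fun e => (z e).1).Adj u v)),
    prod_pairs_filter (fun u v => ¬(u ∈ (restrict τ S).range ∧ v ∈ (restrict τ S).range))
      (fun u v => bern p ((relabel τ fun e => (z e).2).Adj u v)),
    ← prod_edge_perm τ (fun u v =>
      if ¬(u ∈ (restrict τ S).range ∧ v ∈ (restrict τ S).range) then
        bern p ((relabel τ fun e => (z e).2).Adj u v) else 1),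
    ← prod_mul_distrib, ← prod_mul_distrib]
  · refine prod_congr rfl fun e _ => ?_
    simp only [relabel_adj, mem_range_restrict, Equiv.symm_apply_apply, toGraph_adj_edge,
      imageAdj_restrict, edgeLaw, edgeCorr, mem_edgesIn]
    by_cases he : e.1.1 ∈ S ∧ e.1.2 ∈ S
    · simp [he]
    · simp [he, bernPair_zero]
  · intro u v
    simp only [SimpleGraph.adj_comm _ u v, and_comm (a := u ∈ (restrict τ S).range)]

open Classical in
/-- The probability in terms of independent edge indicators. -/
theorem prob_restrict (p ρ : ℝ) (τ : Equiv.Perm (Fin n)) (S : Finset (Fin n))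
    (A : SimpleGraph (Fin n) → SimpleGraph (Fin n) → Prop) :
    prob p ρ (restrict τ S) A = prodExp (edgeLaw p ρ S)
      (fun z => if A (toGraph fun e => (z e).1) (relabel τ fun e => (z e).2) then 1 else 0) := by
  unfold prob prodExp
  rw [← (graphEquiv n).sum_comp,
    ← (Equiv.arrowProdEquivProdArrow (Edge n) (fun _ => Prop) (fun _ => Prop)).symm.sum_comp,
    Fintype.sum_prod_type]
  refine sum_congr rfl fun x _ => ?_
  rw [← ((graphEquiv n).trans (Equiv.simpleGraph τ)).sum_comp]
  refine sum_congr rfl fun y _ => ?_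
  rw [← mass_restrict p ρ τ S, mul_ite, mul_one, mul_zero]
  rfl

theorem bernPair_pos {p ρ : ℝ} (hp : 0 < p) (hp2 : p ≤ 1 / 2) (hρ : 0 ≤ ρ) (hρ1 : ρ < 1)
    (a b : Prop) : 0 < bernPair p ρ a b := by
  have h1 : 0 < 1 - p := by linarith
  have h2 : 0 < 1 - ρ := by linarith
  unfold bernPair
  split_ifs <;> positivity

theorem sum_prop_prod (f : Prop × Prop → ℝ) :
    ∑ a, f a = f (True, True) + f (True, False) + (f (False, True) + f (False, False)) := by
  rw [Fintype.sum_prod_type]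
  simp [Fintype.univ_Prop]

theorem sum_bernPair (p ρ : ℝ) : ∑ a : Prop × Prop, bernPair p ρ a.1 a.2 = 1 := by
  rw [sum_prop_prod]
  simp [bernPair]
  ring

variable {p ρ : ℝ} {S : Finset (Fin n)}

theorem edgeLaw_pos (hp : 0 < p) (hp2 : p ≤ 1 / 2) (hρ : 0 ≤ ρ) (hρ1 : ρ < 1) (e : Edge n)
    (a : Prop × Prop) : 0 < edgeLaw p ρ S e a := by
  unfold edgeLaw edgeCorr
  split_ifs
  · exact bernPair_pos hp hp2 hρ hρ1 _ _
  · exact bernPair_pos hp hp2 le_rfl one_pos _ _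

theorem sum_edgeLaw (e : Edge n) : ∑ a, edgeLaw p ρ S e a = 1 :=
  sum_bernPair _ _

/-- Provides the reference law of the impossibility proof: without correlation the graphs carry no
information about `π`. -/
theorem mass_zero (p : ℝ) (π : PartialMap n) {m : ℕ} (hπ : π ∈ injections n m)
    (G₁ G₂ : SimpleGraph (Fin n)) :
    mass p 0 π G₁ G₂ = (∏ e : Edge n, bern p (G₁.Adj e.1.1 e.1.2)) *
      ∏ e : Edge n, bern p (G₂.Adj e.1.1 e.1.2) := by
  obtain ⟨τ, S, -, rfl⟩ := exists_restrict_eq hπ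
  obtain ⟨x, rfl⟩ := (graphEquiv n).surjective G₁
  obtain ⟨y, rfl⟩ := ((graphEquiv n).trans (Equiv.simpleGraph τ)).surjective G₂
  refine (mass_restrict p 0 τ S fun e => (x e, y e)).trans ?_
  rw [← prod_edge_perm τ (fun u v => bern p
    ((((graphEquiv n).trans (Equiv.simpleGraph τ)) y).Adj u v)), ← prod_mul_distrib]
  · refine prod_congr rfl fun e _ => ?_
    have h1 : (graphEquiv n x).Adj e.1.1 e.1.2 ↔ x e := toGraph_adj_edge x e
    have h2 : (((graphEquiv n).trans (Equiv.simpleGraph τ)) y).Adj (τ e.1.1) (τ e.1.2) ↔ y e := by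
      refine Iff.trans ?_ (toGraph_adj_edge y e)
      refine (relabel_adj τ y _ _).trans ?_
      simp
    rw [edgeLaw, edgeCorr, ite_self, bernPair_zero, propext h1, propext h2]
  · intro u v
    rw [SimpleGraph.adj_comm]

end Mass

/-! ### Counting injections close to a given map. -/

section Counting

variable {n m : ℕ}

/-- An injection is recovered from a list of its `m` source–target pairs. -/
theorem card_injections_le : #(injections n m) ≤ (n * n) ^ m := by
  classical
  have hsub : injections n m ⊆ (univ : Finset (Fin m → Fin n × Fin n)).image
      (fun l v => if h : ∃ i, (l i).1 = v then some (l h.choose).2 else none) := by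
    intro π hπ
    obtain ⟨τ, S, hS, rfl⟩ := exists_restrict_eq hπ
    refine mem_image.2 ⟨fun i => ((S.equivFinOfCardEq hS).symm i,
      τ ((S.equivFinOfCardEq hS).symm i)), mem_univ _, ?_⟩
    funext v
    unfold restrict
    by_cases hv : v ∈ S
    · have h : ∃ i, ((S.equivFinOfCardEq hS).symm i : Fin n) = v :=
        ⟨S.equivFinOfCardEq hS ⟨v, hv⟩, by simp⟩
      rw [dif_pos h, if_pos hv]
      exact congrArg (fun x => some (τ x)) h.choose_spec
    · rw [if_neg hv, dif_neg]
      rintro ⟨i, rfl⟩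
      exact hv (Subtype.prop _)
  refine (card_le_card hsub).trans (card_image_le.trans ?_)
  simp

/-- Given one solution `τ₁`, every other differs from it by a permutation fixing `A` pointwise,
hence a permutation of the remaining `n - #A` points. -/
theorem card_perm_eqOn_le (τ₀ : Equiv.Perm (Fin n)) (A : Finset (Fin n)) (g : Fin n → Fin n) :
    #{τ : Equiv.Perm (Fin n) | ∀ v ∈ A, τ (τ₀ v) = g v} ≤ (n - #A).factorial := by
  classical
  rcases Finset.eq_empty_or_nonempty
    ({τ | ∀ v ∈ A, τ (τ₀ v) = g v} : Finset (Equiv.Perm (Fin n))) with h | ⟨τ₁, h1⟩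
  · rw [h]; simp
  · have hcard : #({f | ∀ v, ¬ v ∉ A → f v = v} : Finset (Equiv.Perm (Fin n))) =
        (n - #A).factorial := by
      rw [← Fintype.card_subtype,
        Fintype.card_congr (Equiv.Perm.subtypeEquivSubtypePerm (fun v : Fin n => v ∉ A)).symm,
        Fintype.card_perm, Fintype.card_subtype_compl, Fintype.card_fin, Fintype.card_coe]
    rw [← hcard]
    refine card_le_card_of_injOn (fun τ => (τ₁ * τ₀)⁻¹ * τ * τ₀) ?_ ?_
    · intro τ hτ
      simp only [coe_filter, mem_univ, true_and, Set.mem_ofPred_eq, not_not] at hτ ⊢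
      intro v hv
      simp only [mem_filter, mem_univ, true_and] at h1
      rw [Equiv.Perm.mul_apply, Equiv.Perm.mul_apply, hτ v hv, ← h1 v hv,
        Equiv.Perm.inv_eq_iff_eq, Equiv.Perm.mul_apply]
    · intro τ _ τ' _ h
      exact mul_left_cancel (mul_right_cancel h)

/-- The vertices at which two partial maps agree. -/
def agreement (π π' : PartialMap n) : Finset (Fin n) :=
  {v | ∃ w, π v = some w ∧ π' v = some w}

theorem card_perm_agreement_le (τ₀ : Equiv.Perm (Fin n)) (S : Finset (Fin n)) (η : PartialMap n)
    (k : ℕ) :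
    #{τ : Equiv.Perm (Fin n) | k ≤ #(agreement (restrict (τ * τ₀) S) η)} ≤
      (#S).choose k * (n - k).factorial := by
  classical
  have hsub : ({τ | k ≤ #(agreement (restrict (τ * τ₀) S) η)} : Finset (Equiv.Perm (Fin n))) ⊆
      (S.powersetCard k).biUnion fun A => {τ | ∀ v ∈ A, τ (τ₀ v) = (η v).getD v} := by
    intro τ hτ
    simp only [mem_filter, mem_univ, true_and] at hτ
    obtain ⟨A, hA, hAk⟩ := exists_subset_card_eq hτ
    -- `η` is defined on this `A`, so the default value of `getD` is not used here.
    have hAv : ∀ v ∈ A, v ∈ S ∧ τ (τ₀ v) = (η v).getD v := by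
      intro v hv
      have := hA hv
      simp only [agreement, mem_filter, mem_univ, true_and, restrict_eq_some] at this
      obtain ⟨w, ⟨h1, h2⟩, h3⟩ := this
      refine ⟨h1, ?_⟩
      rw [h3]
      exact h2
    simp only [mem_biUnion, mem_powersetCard, mem_filter, mem_univ, true_and]
    exact ⟨A, ⟨fun v hv => (hAv v hv).1, hAk⟩, fun v hv => (hAv v hv).2⟩
  refine (card_le_card hsub).trans (card_biUnion_le.trans ?_)
  rw [← card_powersetCard, ← smul_eq_mul]
  refine sum_le_card_nsmul _ _ _ fun A hA => ?_
  rw [← (mem_powersetCard.1 hA).2]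
  exact card_perm_eqOn_le τ₀ A _

theorem map_restrict (τ τ₀ : Equiv.Perm (Fin n)) (S : Finset (Fin n)) :
    (fun v => (restrict τ₀ S v).map τ) = restrict (τ * τ₀) S := by
  funext v
  unfold restrict
  split_ifs <;> simp

/-- Double counting: composing with a permutation of the targets permutes `injections n m`, so the
count can be averaged over all `n!` permutations, while for each injection few of them produce `k`
agreements (`card_perm_agreement_le`). The factor `2 ^ m` bounds `m.choose k`. -/
theorem card_agreement_mul_descFactorial_le (η : PartialMap n) (k : ℕ) :
    #{π ∈ injections n m | k ≤ #(agreement π η)} * n.descFactorial k ≤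
      #(injections n m) * 2 ^ m := by
  classical
  rcases lt_or_ge n k with hk | hk
  · rw [Nat.descFactorial_eq_zero_iff_lt.2 hk]; simp
  have hshift : ∀ τ : Equiv.Perm (Fin n), #{π ∈ injections n m | k ≤ #(agreement π η)} =
      #{π ∈ injections n m | k ≤ #(agreement (fun v => (π v).map τ) η)} := by
    intro τ
    have hmem : ∀ (τ : Equiv.Perm (Fin n)), ∀ π ∈ injections n m,
        (fun v => (π v).map τ) ∈ injections n m := by
      intro τ π hπ
      obtain ⟨τ₀, S, rfl, rfl⟩ := exists_restrict_eq hπ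
      rw [map_restrict]
      exact restrict_mem_injections _ _
    refine card_bij' (fun π _ v => (π v).map τ.symm) (fun π _ v => (π v).map τ) ?_ ?_ ?_ ?_
    · intro π hπ
      rw [mem_filter] at hπ ⊢
      refine ⟨hmem τ.symm π hπ.1, ?_⟩
      simpa [Option.map_map, Function.comp_def] using hπ.2
    · intro π hπ
      rw [mem_filter] at hπ ⊢
      exact ⟨hmem τ π hπ.1, hπ.2⟩
    · intro π _
      funext v
      simp [Option.map_map]
    · intro π _
      funext v
      simp [Option.map_map]
  have hsum : n.factorial * #{π ∈ injections n m | k ≤ #(agreement π η)} ≤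
      #(injections n m) * (m.choose k * (n - k).factorial) := by
    calc n.factorial * #{π ∈ injections n m | k ≤ #(agreement π η)}
        = ∑ τ : Equiv.Perm (Fin n),
            #{π ∈ injections n m | k ≤ #(agreement (fun v => (π v).map τ) η)} := by
          rw [sum_congr rfl fun τ _ => (hshift τ).symm, sum_const, card_univ, Fintype.card_perm,
            Fintype.card_fin, smul_eq_mul]
      _ = ∑ π ∈ injections n m, #{τ : Equiv.Perm (Fin n) |
            k ≤ #(agreement (fun v => (π v).map τ) η)} := by
          simp only [card_filter]
          exact sum_comm
      _ ≤ _ := by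
          rw [← smul_eq_mul]
          refine sum_le_card_nsmul _ _ _ fun π hπ => ?_
          obtain ⟨τ₀, S, rfl, rfl⟩ := exists_restrict_eq hπ
          simp only [map_restrict]
          exact card_perm_agreement_le τ₀ S η k
  have hf : 0 < (n - k).factorial := Nat.factorial_pos _
  rw [← Nat.factorial_mul_descFactorial hk] at hsum
  refine Nat.le_of_mul_le_mul_left ?_ hf
  calc _ = (n - k).factorial * n.descFactorial k *
          #{π ∈ injections n m | k ≤ #(agreement π η)} := by ring
    _ ≤ _ := hsum
    _ ≤ #(injections n m) * (2 ^ m * (n - k).factorial) := by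
        gcongr
        exact Nat.choose_le_two_pow m k
    _ = _ := by ring

end Counting

/-! ### Estimates for `phi`, `signal` and the relative entropy of one edge. -/

section Analysis

theorem sq_div_le_phi {x : ℝ} (hx : 0 ≤ x) : x ^ 2 / (2 + x) ≤ phi x := by
  have h := Real.le_log_one_add_of_nonneg hx
  have h2 : (1 + x) * (2 * x / (x + 2)) ≤ (1 + x) * Real.log (1 + x) := by gcongr
  have h3 : (1 + x) * (2 * x / (x + 2)) - x = x ^ 2 / (2 + x) := by
    field_simp
    ring
  unfold phi
  linarith

theorem phi_pos {x : ℝ} (hx : 0 < x) : 0 < phi x :=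
  lt_of_lt_of_le (by positivity) (sq_div_le_phi hx.le)

theorem phi_le_mul_log {x : ℝ} (hx : 0 ≤ x) : phi x ≤ x * Real.log (1 + x) := by
  have := Real.log_le_sub_one_of_pos (show 0 < 1 + x by linarith)
  unfold phi
  linarith

theorem phi_le_sq {x : ℝ} (hx : 0 ≤ x) : phi x ≤ x ^ 2 := by
  have := Real.log_le_sub_one_of_pos (show 0 < 1 + x by linarith)
  nlinarith [phi_le_mul_log hx]

/-- Converts the upper-tail exponent at the midpoint threshold, which involves `phi (x / 2)`, into
`phi x`. With `x = 2y` it rests on `1 + 2y ≤ (1 + y)²`. -/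
theorem phi_le_eight_mul_phi_half {x : ℝ} (hx : 0 ≤ x) : phi x ≤ 8 * phi (x / 2) := by
  have hy : 0 ≤ x / 2 := by linarith
  obtain ⟨y, rfl⟩ : ∃ y, x = 2 * y := ⟨x / 2, by ring⟩
  have hy : 0 ≤ y := by linarith
  have h1 : Real.log (1 + 2 * y) ≤ 2 * Real.log (1 + y) := by
    rw [← Real.log_rpow (by linarith), Real.rpow_two]
    exact Real.log_le_log (by linarith) (by nlinarith)
  have h2 := Real.le_log_one_add_of_nonneg hy
  have h3 : (6 + 4 * y) * (2 * y / (y + 2)) - 6 * y = 2 * y ^ 2 / (y + 2) := by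
    field_simp
    ring
  have h4 : 0 ≤ 2 * y ^ 2 / (y + 2) := by positivity
  have h5 : (6 + 4 * y) * (2 * y / (y + 2)) ≤ (6 + 4 * y) * Real.log (1 + y) := by gcongr
  have h6 : (1 + 2 * y) * Real.log (1 + 2 * y) ≤ (1 + 2 * y) * (2 * Real.log (1 + y)) := by gcongr
  rw [mul_div_cancel_left₀ y two_ne_zero]
  unfold phi
  linarith

/-- The identity `(1 - s + s²/2) (1 + s + s²/2) = 1 + s⁴/4` combines with the quadratic lower bound
for `exp s`. -/
theorem exp_neg_le {s : ℝ} (hs : 0 ≤ s) : Real.exp (-s) ≤ 1 - s + s ^ 2 / 2 := by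
  have h := Real.quadratic_le_exp_of_nonneg hs
  rw [Real.exp_neg, inv_le_iff_one_le_mul₀ (Real.exp_pos s)]
  have h1 : 0 ≤ 1 - s + s ^ 2 / 2 := by nlinarith [sq_nonneg (1 - s)]
  nlinarith [mul_le_mul_of_nonneg_left h h1, sq_nonneg (s ^ 2)]

variable {p ρ : ℝ}

theorem signal_pos (hp : 0 < p) (hp2 : p ≤ 1 / 2) (hρ : 0 < ρ) : 0 < signal p ρ := by
  have : 0 < 1 - p := by linarith
  unfold signal
  positivity

theorem mul_signal (hp : 0 < p) : p * signal p ρ = ρ * (1 - p) := by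
  unfold signal
  field_simp

theorem mul_one_add_signal_le (hp : 0 < p) (hp2 : p ≤ 1 / 2) (hρ1 : ρ < 1) :
    p * (1 + signal p ρ) ≤ 1 := by
  have := mul_signal (ρ := ρ) hp
  nlinarith

theorem bernPair_true (hp : 0 < p) :
    p ^ 2 + ρ * p * (1 - p) = p ^ 2 * (1 + signal p ρ) := by
  have := mul_signal (ρ := ρ) hp
  linear_combination -p * this

theorem sq_mul_le_phi (hp : 0 < p) (hp2 : p ≤ 1 / 2) (hρ : 0 < ρ) (hρ1 : ρ < 1) :
    ρ ^ 2 * p ≤ 6 * (p ^ 2 * phi (signal p ρ)) := by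
  have hγ := signal_pos hp hp2 hρ
  have hm := mul_signal (ρ := ρ) hp
  have h1 := mul_one_add_signal_le hp hp2 hρ1
  set γ := signal p ρ
  have h2 : ρ ^ 2 * p ≤ 6 * (p ^ 2 * (γ ^ 2 / (2 + γ))) := by
    have : 6 * (p ^ 2 * (γ ^ 2 / (2 + γ))) = 6 * (p * γ) ^ 2 / (2 + γ) := by ring
    rw [this, hm, le_div_iff₀ (by linarith)]
    have h3 : p * (2 + γ) ≤ 3 / 2 := by linarith
    have h4 : (1 : ℝ) / 4 ≤ (1 - p) ^ 2 := by nlinarith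
    nlinarith [sq_nonneg ρ]
  refine h2.trans ?_
  have := sq_div_le_phi hγ.le
  gcongr

/-- The terms of first order in `ρ` cancel. Beyond `p² φ(γ)` there remains at most `2 ρ² p`, which
`sq_mul_le_phi` bounds by `12 p² φ(γ)`. -/
theorem kl_bernPair_le (hp : 0 < p) (hp2 : p ≤ 1 / 2) (hρ : 0 < ρ) (hρ1 : ρ < 1) :
    ∑ a : Prop × Prop, bernPair p ρ a.1 a.2 *
      Real.log (bernPair p ρ a.1 a.2 / bernPair p 0 a.1 a.2) ≤
      13 * (p ^ 2 * phi (signal p ρ)) := by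
  have hp1 : 0 < 1 - p := by linarith
  have hρ' : 0 < 1 - ρ := by linarith
  have hγ := signal_pos hp hp2 hρ
  have hsq := sq_mul_le_phi hp hp2 hρ hρ1
  have hm := mul_signal (ρ := ρ) hp
  have hTT : bernPair p ρ True True * Real.log (bernPair p ρ True True / bernPair p 0 True True) =
      p ^ 2 * phi (signal p ρ) + ρ * p * (1 - p) := by
    have h1 : bernPair p ρ True True = p ^ 2 * (1 + signal p ρ) := by
      simp only [bernPair, if_true]
      exact bernPair_true hp
    have h2 : bernPair p 0 True True = p ^ 2 := by simp [bernPair]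
    rw [h1, h2, mul_div_cancel_left₀ _ (by positivity)]
    unfold phi
    linear_combination p * hm
  have hTF : (1 - ρ) * p * (1 - p) * Real.log ((1 - ρ) * p * (1 - p) / (p * (1 - p))) ≤
      - (ρ * (1 - ρ) * p * (1 - p)) := by
    rw [mul_assoc (1 - ρ), mul_div_cancel_right₀ _ (by positivity)]
    have h := Real.log_le_sub_one_of_pos hρ'
    have h2 : (1 - ρ) * (p * (1 - p)) * Real.log (1 - ρ) ≤ (1 - ρ) * (p * (1 - p)) * (-ρ) := by
      gcongr
      linarith
    linarith
  have hFF : ((1 - p) ^ 2 + ρ * p * (1 - p)) *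
      Real.log (((1 - p) ^ 2 + ρ * p * (1 - p)) / (1 - p) ^ 2) ≤ ρ * p * (1 - p) + ρ ^ 2 * p ^ 2 := by
    have h1 : ((1 - p) ^ 2 + ρ * p * (1 - p)) / (1 - p) ^ 2 = 1 + ρ * p / (1 - p) := by
      field_simp
    have h := Real.log_le_sub_one_of_pos (show 0 < 1 + ρ * p / (1 - p) by positivity)
    rw [h1]
    have h2 : ((1 - p) ^ 2 + ρ * p * (1 - p)) * Real.log (1 + ρ * p / (1 - p)) ≤
        ((1 - p) ^ 2 + ρ * p * (1 - p)) * (ρ * p / (1 - p)) := by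
      gcongr
      linarith
    refine h2.trans (le_of_eq ?_)
    field_simp
  rw [sum_prop_prod]
  dsimp only
  rw [hTT]
  simp only [bernPair, if_true, if_false, sub_zero, zero_mul, add_zero, one_mul]
  nlinarith [mul_pos (mul_pos hρ hρ) (mul_pos hp hp)]

theorem sq_mul_phi_le_one (hp : 0 < p) (hp2 : p ≤ 1 / 2) (hρ : 0 < ρ) (hρ1 : ρ < 1) :
    p ^ 2 * phi (signal p ρ) ≤ 1 := by
  have hγ := signal_pos hp hp2 hρ
  have h1 := mul_one_add_signal_le hp hp2 hρ1
  have h2 := phi_le_sq hγ.le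
  calc p ^ 2 * phi (signal p ρ) ≤ p ^ 2 * signal p ρ ^ 2 := by gcongr
    _ = (p * signal p ρ) ^ 2 := by ring
    _ ≤ 1 := pow_le_one₀ (by positivity) (by nlinarith)

/-- Compares the exponents of the two tails: they agree up to a constant for `γ ≤ 1`, and for larger
`γ` the gap is `log (1 + γ) ≤ -log p`, as `p (1 + γ) ≤ 1`. -/
theorem phi_signal_le {L : ℝ} (hL : 1 ≤ L) (hp : 0 < p) (hp2 : p ≤ 1 / 2) (hρ : 0 < ρ)
    (hρ1 : ρ < 1) (hpL : -Real.log p ≤ L) :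
    phi (signal p ρ) ≤ 2 * (signal p ρ ^ 2 / (1 + signal p ρ)) * L := by
  have hγ := signal_pos hp hp2 hρ
  have h1 := mul_one_add_signal_le hp hp2 hρ1
  set γ := signal p ρ
  have hlog : Real.log (1 + γ) ≤ L := by
    refine le_trans ?_ hpL
    rw [← Real.log_inv]
    refine Real.log_le_log (by linarith) ?_
    rw [le_inv_comm₀ (by linarith) hp, ← one_div, le_div_iff₀ (by linarith)]
    exact h1
  rcases le_total γ 1 with h | h
  · refine (phi_le_sq hγ.le).trans ?_
    have h2 : γ ^ 2 ≤ 2 * (γ ^ 2 / (1 + γ)) := by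
      rw [mul_div_assoc', le_div_iff₀ (by linarith)]
      nlinarith [sq_nonneg γ]
    refine h2.trans (le_mul_of_one_le_right (by positivity) hL)
  · refine (phi_le_mul_log hγ.le).trans ?_
    have h2 : γ ≤ 2 * (γ ^ 2 / (1 + γ)) := by
      rw [mul_div_assoc', le_div_iff₀ (by linarith)]
      nlinarith
    have : 0 ≤ Real.log (1 + γ) := Real.log_nonneg (by linarith)
    gcongr

end Analysis

/-! ### Impossibility by comparison with uncorrelated graphs. -/

section Impossibility

-- A form of the Donsker–Varadhan bound, obtained by summing `P (y - log (P / Q)) ≤ Q exp y - P`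
-- with `y = x` on `A` and `y = 0` elsewhere.
open Classical in
theorem mul_sum_le_relEntropy_add {Ω : Type*} [Fintype Ω] {P Q : Ω → ℝ} (hP : ∀ z, 0 < P z)
    (hQ : ∀ z, 0 < Q z) (hP1 : ∑ z, P z = 1) (hQ1 : ∑ z, Q z = 1) (x : ℝ) (A : Ω → Prop) :
    x * ∑ z, P z * (if A z then 1 else 0) ≤
      ∑ z, P z * Real.log (P z / Q z) + Real.exp x * ∑ z, Q z * (if A z then 1 else 0) := by
  have h : ∀ z, x * (P z * (if A z then 1 else 0)) + P z ≤
      P z * Real.log (P z / Q z) + Q z + Real.exp x * (Q z * (if A z then 1 else 0)) := by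
    intro z
    have hlog : ∀ y : ℝ, P z * (y - Real.log (P z / Q z)) ≤ Q z * Real.exp y - P z := by
      intro y
      have h1 := Real.add_one_le_exp (y - Real.log (P z / Q z))
      rw [Real.exp_sub, Real.exp_log (div_pos (hP z) (hQ z))] at h1
      have h2 := mul_le_mul_of_nonneg_left h1 (hP z).le
      have h3 : P z * (Real.exp y / (P z / Q z)) = Q z * Real.exp y := by
        have := (hP z).ne'
        have := (hQ z).ne'
        field_simp
      linarith
    split_ifs
    · have := hlog x
      have := hQ z
      linarith
    · have := hlog 0
      rw [Real.exp_zero] at this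
      linarith
  have hs := sum_le_sum fun z (_ : z ∈ univ) => h z
  simp only [sum_add_distrib, ← mul_sum, hP1, hQ1] at hs
  linarith

variable {n m : ℕ} {p ρ : ℝ}

theorem prodExp_log_edgeLaw_le (hp : 0 < p) (hp2 : p ≤ 1 / 2) (hρ : 0 < ρ) (hρ1 : ρ < 1)
    (S : Finset (Fin n)) :
    prodExp (edgeLaw p ρ S)
      (fun z => Real.log ((∏ e, edgeLaw p ρ S e (z e)) / ∏ e, edgeLaw p 0 S e (z e))) ≤
      13 * (#S : ℝ) ^ 2 * (p ^ 2 * phi (signal p ρ)) := by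
  classical
  have h1 : ∀ e a, edgeLaw p ρ S e a ≠ 0 := fun e a => (edgeLaw_pos hp hp2 hρ.le hρ1 e a).ne'
  have h0 : ∀ e a, edgeLaw p 0 S e a ≠ 0 := fun e a => (edgeLaw_pos hp hp2 le_rfl one_pos e a).ne'
  have hlog : ∀ z : Edge n → Prop × Prop,
      Real.log ((∏ e, edgeLaw p ρ S e (z e)) / ∏ e, edgeLaw p 0 S e (z e)) =
        ∑ e, Real.log (edgeLaw p ρ S e (z e) / edgeLaw p 0 S e (z e)) := by
    intro z
    rw [← prod_div_distrib, Real.log_prod fun e _ => div_ne_zero (h1 e _) (h0 e _)]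
  simp only [hlog]
  rw [prodExp_sum, sum_congr rfl fun e _ => prodExp_coord sum_edgeLaw e
    (fun a => Real.log (edgeLaw p ρ S e a / edgeLaw p 0 S e a))]
  have hphi : 0 < p ^ 2 * phi (signal p ρ) :=
    mul_pos (by positivity) (phi_pos (signal_pos hp hp2 hρ))
  have hbound : ∀ e : Edge n, ∑ a, edgeLaw p ρ S e a *
      Real.log (edgeLaw p ρ S e a / edgeLaw p 0 S e a) ≤
      if e ∈ edgesIn S then 13 * (p ^ 2 * phi (signal p ρ)) else 0 := by
    intro e
    split_ifs with he
    · simp only [edgeLaw, edgeCorr, he, if_true, ite_self]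
      exact kl_bernPair_le hp hp2 hρ hρ1
    · refine le_of_eq (sum_eq_zero fun a _ => ?_)
      have : edgeLaw p ρ S e a = edgeLaw p 0 S e a := by simp [edgeLaw, edgeCorr, he]
      rw [this, div_self (h0 e a), Real.log_one, mul_zero]
  refine (sum_le_sum fun e _ => hbound e).trans ?_
  rw [← sum_filter, filter_mem_eq_inter, univ_inter, sum_const, nsmul_eq_mul]
  have hcard : (#(edgesIn S) : ℝ) ≤ (#S : ℝ) ^ 2 := by
    have h2 := two_mul_card_edgesIn S
    have h3 : #S * (#S - 1) ≤ #S ^ 2 := by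
      rw [pow_two]
      exact Nat.mul_le_mul_left _ (Nat.sub_le _ _)
    exact_mod_cast show #(edgesIn S) ≤ #S ^ 2 by omega
  nlinarith [mul_le_mul_of_nonneg_right hcard hphi.le]

theorem mul_prob_le (hp : 0 < p) (hp2 : p ≤ 1 / 2) (hρ : 0 < ρ) (hρ1 : ρ < 1)
    {π : PartialMap n} (hπ : π ∈ injections n m) (x : ℝ)
    (A : SimpleGraph (Fin n) → SimpleGraph (Fin n) → Prop) :
    x * prob p ρ π A ≤
      13 * (m : ℝ) ^ 2 * (p ^ 2 * phi (signal p ρ)) + Real.exp x * prob p 0 π A := by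
  obtain ⟨τ, S, rfl, rfl⟩ := exists_restrict_eq hπ
  have hsum : ∀ ρ' : ℝ, ∑ z : Edge n → Prop × Prop, ∏ e, edgeLaw p ρ' S e (z e) = 1 := by
    intro ρ'
    simpa [prodExp] using prodExp_one (w := edgeLaw p ρ' S) sum_edgeLaw
  rw [prob_restrict, prob_restrict]
  refine (mul_sum_le_relEntropy_add
    (fun z => prod_pos fun e _ => edgeLaw_pos hp hp2 hρ.le hρ1 e (z e))
    (fun z => prod_pos fun e _ => edgeLaw_pos hp hp2 le_rfl one_pos e (z e))
    (hsum ρ) (hsum 0) x _).trans ?_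
  have := prodExp_log_edgeLaw_le hp hp2 hρ hρ1 S
  unfold prodExp at this ⊢
  gcongr

theorem prob_add_prob_not {π : PartialMap n} (hπ : π ∈ injections n m) (p ρ : ℝ)
    (A B : SimpleGraph (Fin n) → SimpleGraph (Fin n) → Prop) (hAB : ∀ G₁ G₂, B G₁ G₂ ↔ ¬ A G₁ G₂) :
    prob p ρ π A + prob p ρ π B = 1 := by
  classical
  obtain ⟨τ, S, rfl, rfl⟩ := exists_restrict_eq hπ
  rw [prob_restrict, prob_restrict, ← prodExp_add]
  refine Eq.trans ?_ (prodExp_one (w := edgeLaw p ρ S) sum_edgeLaw)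
  congr 1
  funext z
  simp only [hAB]
  split_ifs <;> simp_all

theorem overlap_eq {π : PartialMap n} (hπ : π ∈ injections n m) (η : PartialMap n) :
    overlap π η = (#(agreement π η) : ℝ) / m := by
  rw [overlap, (mem_injections.1 hπ).1]
  rfl

theorem card_overlap_le {δ : ℝ} (hδ : 0 < δ) (hδ1 : δ < 1) (hm : 0 < m) (hmn : m ≤ n)
    (hn : 8 / δ ≤ Real.log n) (η : PartialMap n) :
    Real.exp (δ / 4 * m * Real.log n) * (#{π ∈ injections n m | δ ≤ overlap π η} : ℝ) ≤
      #(injections n m) := by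
  classical
  have hmR : (0 : ℝ) < m := by exact_mod_cast hm
  have hmnR : (m : ℝ) ≤ n := by exact_mod_cast hmn
  have hnR : (0 : ℝ) < n := by linarith
  have hlog8 : 8 ≤ Real.log n := by
    refine le_trans ?_ hn
    rw [le_div_iff₀ hδ]
    linarith
  have hlog2 : Real.log 2 ≤ 1 := by linarith [Real.log_two_lt_d9]
  -- Asking for only half of the `δ m` agreements keeps `n + 1 - k` above `n / 2` even when `δ m` is
  -- close to `n`.
  set k := ⌈δ * m / 2⌉₊ with hk
  have hk1 : δ * m / 2 ≤ k := Nat.le_ceil _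
  have hk2 : (k : ℝ) < δ * m / 2 + 1 := Nat.ceil_lt_add_one (by positivity)
  have hkn : (n : ℝ) / 2 ≤ ((n + 1 - k : ℕ) : ℝ) := by
    have h1 : δ * m ≤ n := by nlinarith
    rcases le_total k (n + 1) with h | h
    · rw [Nat.cast_sub h]
      push_cast
      linarith
    · have : ((n + 1 : ℕ) : ℝ) ≤ k := by exact_mod_cast h
      push_cast at this
      linarith
  have hsub : (#{π ∈ injections n m | δ ≤ overlap π η} : ℝ) ≤
      #{π ∈ injections n m | k ≤ #(agreement π η)} := by
    refine Nat.cast_le.2 (card_le_card fun π hπ => ?_)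
    rw [mem_filter] at hπ ⊢
    refine ⟨hπ.1, Nat.ceil_le.2 ?_⟩
    have h := hπ.2
    rw [overlap_eq hπ.1, le_div_iff₀ hmR] at h
    nlinarith
  have hdesc : ((n : ℝ) / 2) ^ k ≤ (n.descFactorial k : ℝ) := by
    refine (pow_le_pow_left₀ (by positivity) hkn k).trans ?_
    exact_mod_cast Nat.pow_sub_le_descFactorial n k
  have hcount : (#{π ∈ injections n m | k ≤ #(agreement π η)} : ℝ) * n.descFactorial k ≤
      #(injections n m) * 2 ^ m := by
    exact_mod_cast card_agreement_mul_descFactorial_le η k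
  have hpow : Real.exp (δ / 4 * m * Real.log n) * 2 ^ m ≤ ((n : ℝ) / 2) ^ k := by
    have e1 : ((n : ℝ) / 2) ^ k = Real.exp (k * (Real.log n - Real.log 2)) := by
      rw [← Real.log_div hnR.ne' two_ne_zero, mul_comm, Real.exp_mul,
        Real.exp_log (by positivity), Real.rpow_natCast]
    have e2 : (2 : ℝ) ^ m = Real.exp (m * Real.log 2) := by
      rw [mul_comm, Real.exp_mul, Real.exp_log two_pos, Real.rpow_natCast]
    rw [e1, e2, ← Real.exp_add, Real.exp_le_exp]
    have h1 : δ * m / 2 * (Real.log n - Real.log 2) ≤ k * (Real.log n - Real.log 2) := by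
      refine mul_le_mul_of_nonneg_right hk1 (by linarith)
    have h2 : 8 ≤ δ * Real.log n := by
      rw [div_le_iff₀ hδ] at hn
      linarith
    have h3 : m * Real.log 2 ≤ m * 1 := by gcongr
    have h4 : δ * m / 2 * Real.log 2 ≤ 1 * m / 2 * 1 := by
      have : 0 ≤ Real.log 2 := Real.log_nonneg one_le_two
      gcongr
    nlinarith [mul_le_mul_of_nonneg_left h2 hmR.le]
  have h2m : (0 : ℝ) < 2 ^ m := by positivity
  refine le_of_mul_le_mul_right ?_ h2m
  calc Real.exp (δ / 4 * m * Real.log n) * (#{π ∈ injections n m | δ ≤ overlap π η} : ℝ) * 2 ^ m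
      ≤ Real.exp (δ / 4 * m * Real.log n) * #{π ∈ injections n m | k ≤ #(agreement π η)} * 2 ^ m := by
        gcongr
    _ = #{π ∈ injections n m | k ≤ #(agreement π η)} *
          (Real.exp (δ / 4 * m * Real.log n) * 2 ^ m) := by ring
    _ ≤ #{π ∈ injections n m | k ≤ #(agreement π η)} * (n.descFactorial k : ℝ) := by
        gcongr
        exact hpow.trans hdesc
    _ ≤ _ := hcount

/-- All injections share one law at `ρ = 0`, so the sum over `π` moves inside and, for each pair of
graphs, counts the injections close to a fixed output. -/
theorem exp_mul_sum_prob_zero_le (hp : 0 < p) (hp2 : p ≤ 1 / 2) {δ : ℝ} (hδ : 0 < δ) (hδ1 : δ < 1)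
    (hm : 0 < m) (hmn : m ≤ n) (hn : 8 / δ ≤ Real.log n) (est : Estimator n) :
    Real.exp (δ / 4 * m * Real.log n) *
      ∑ π ∈ injections n m, prob p 0 π (fun G₁ G₂ => δ ≤ overlap π (est G₁ G₂)) ≤
      #(injections n m) := by
  classical
  obtain ⟨π₀, hπ₀⟩ := injections_nonempty hmn
  have hzero : ∀ π ∈ injections n m, ∀ A : SimpleGraph (Fin n) → SimpleGraph (Fin n) → Prop,
      prob p 0 π A = ∑ G₁, ∑ G₂, mass p 0 π₀ G₁ G₂ * (if A G₁ G₂ then 1 else 0) := by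
    intro π hπ A
    unfold prob
    refine sum_congr rfl fun G₁ _ => sum_congr rfl fun G₂ _ => ?_
    rw [mass_zero p π hπ, mass_zero p π₀ hπ₀, mul_ite, mul_one, mul_zero]
  have hnonneg : ∀ G₁ G₂, 0 ≤ mass p 0 π₀ G₁ G₂ := by
    intro G₁ G₂
    have hb : ∀ a : Prop, 0 ≤ bern p a := by
      intro a
      unfold bern
      split_ifs <;> linarith
    rw [mass_zero p π₀ hπ₀]
    exact mul_nonneg (prod_nonneg fun _ _ => hb _) (prod_nonneg fun _ _ => hb _)
  have htotal : ∑ G₁, ∑ G₂, mass p 0 π₀ G₁ G₂ = 1 := by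
    have h := prob_add_prob_not hπ₀ p 0 (fun _ _ => True) (fun _ _ => False) (by simp)
    simpa [prob] using h
  have hswap : ∑ π ∈ injections n m, prob p 0 π (fun G₁ G₂ => δ ≤ overlap π (est G₁ G₂)) =
      ∑ G₁, ∑ G₂, mass p 0 π₀ G₁ G₂ *
        ∑ π ∈ injections n m, if δ ≤ overlap π (est G₁ G₂) then 1 else 0 := by
    rw [sum_congr rfl fun π hπ => hzero π hπ _, sum_comm]
    refine sum_congr rfl fun G₁ _ => ?_
    rw [sum_comm]
    exact sum_congr rfl fun G₂ _ => (mul_sum _ _ _).symm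
  rw [hswap, mul_sum, sum_congr rfl fun G₁ _ => mul_sum _ _ _]
  calc _ ≤ ∑ G₁, ∑ G₂, mass p 0 π₀ G₁ G₂ * (#(injections n m) : ℝ) := by
        refine sum_le_sum fun G₁ _ => sum_le_sum fun G₂ _ => ?_
        rw [mul_left_comm]
        refine mul_le_mul_of_nonneg_left ?_ (hnonneg _ _)
        rw [← sum_filter, sum_const, nsmul_eq_mul, mul_one]
        exact card_overlap_le hδ hδ1 hm hmn hn (est G₁ G₂)
    _ = _ := by
        simp only [← sum_mul, htotal, one_mul]

theorem impossibility {c δ : ℝ} (hc : 0 < c) (hδ : 0 < δ) (hδ1 : δ < 1) (hmn : m ≤ n)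
    (hp : 0 < p) (hp2 : p ≤ 1 / 2) (hρ : 0 < ρ) (hρ1 : ρ < 1)
    (hn : 8 / δ ≤ Real.log n) (hn' : 8 / (c * δ) ≤ Real.log n)
    (h : (m : ℝ) ≤ c * δ / 104 * Real.log n / (p ^ 2 * phi (signal p ρ))) (est : Estimator n) :
    1 - c ≤ bayesProb n m p ρ (fun π G₁ G₂ => overlap π (est G₁ G₂) < δ) := by
  classical
  have hcard : (0 : ℝ) < #(injections n m) := by
    exact_mod_cast card_pos.2 (injections_nonempty hmn)
  set good : PartialMap n → ℝ := fun π =>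
    prob p ρ π (fun G₁ G₂ => δ ≤ overlap π (est G₁ G₂)) with hgood
  have hcompl : ∑ π ∈ injections n m, prob p ρ π (fun G₁ G₂ => overlap π (est G₁ G₂) < δ) =
      #(injections n m) - ∑ π ∈ injections n m, good π := by
    rw [eq_sub_iff_add_eq', ← sum_add_distrib, sum_congr rfl fun π hπ =>
      prob_add_prob_not hπ p ρ _ _ fun G₁ G₂ => not_le.symm]
    simp
  unfold bayesProb
  rw [hcompl, sub_div, div_self hcard.ne', sub_le_sub_iff_left, div_le_iff₀ hcard]
  -- For `m = 0` the overlap is `0 / 0 = 0`, below `δ`.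
  rcases Nat.eq_zero_or_pos m with rfl | hm
  · have : ∑ π ∈ injections n 0, good π = 0 := by
      refine sum_eq_zero fun π hπ => ?_
      simp [hgood, prob, overlap_eq hπ, not_le.2 hδ]
    rw [this]
    positivity
  have hmR : (1 : ℝ) ≤ m := by exact_mod_cast hm
  have hphi : 0 < p ^ 2 * phi (signal p ρ) :=
    mul_pos (by positivity) (phi_pos (signal_pos hp hp2 hρ))
  set V := p ^ 2 * phi (signal p ρ)
  rw [le_div_iff₀ hphi] at h
  rw [div_le_iff₀ (by positivity)] at hn'
  have hlog : 0 < Real.log n := lt_of_lt_of_le (by positivity) hn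
  have hsum := sum_le_sum (s := injections n m) fun π hπ => mul_prob_le hp hp2 hρ hρ1 hπ (δ / 4 * m * Real.log n)
    (fun G₁ G₂ => δ ≤ overlap π (est G₁ G₂))
  rw [← mul_sum, sum_add_distrib, sum_const, nsmul_eq_mul, ← mul_sum] at hsum
  have hzero := exp_mul_sum_prob_zero_le hp hp2 hδ hδ1 hm hmn hn est
  have hx : 0 < δ / 4 * m * Real.log n := by positivity
  refine le_of_mul_le_mul_left ?_ hx
  -- Since `104 = 8 * 13`, the entropy term takes at most half of the right side; the other half is
  -- at least `1` by `hn'`.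
  have hb : 13 * (m : ℝ) ^ 2 * V + 1 ≤ δ / 4 * m * Real.log n * c := by
    have h1 : m * (m * V) ≤ m * (c * δ / 104 * Real.log n) := by gcongr
    nlinarith
  calc _ ≤ #(injections n m) * (13 * (m : ℝ) ^ 2 * V) + #(injections n m) := by
        linarith
    _ = #(injections n m) * (13 * (m : ℝ) ^ 2 * V + 1) := by ring
    _ ≤ #(injections n m) * (δ / 4 * m * Real.log n * c) := by gcongr
    _ = _ := by ring

end Impossibility

/-! ### Tail bounds and the union bound for edge overlap maximizers. -/

section Possibility

variable {n m : ℕ} {p ρ : ℝ}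

open Classical in
/-- The indicator that `e` is an edge of the first graph and `e'` one of the second. -/
def hit (z : Edge n → Prop × Prop) (e e' : Edge n) : ℝ :=
  if (z e).1 ∧ (z e').2 then 1 else 0

theorem edgeOverlap_restrict (τ₀ τ : Equiv.Perm (Fin n)) (S : Finset (Fin n))
    (z : Edge n → Prop × Prop) :
    (edgeOverlap (restrict τ S) (toGraph fun e => (z e).1) (relabel τ₀ fun e => (z e).2) : ℝ) =
      ∑ e ∈ edgesIn S, hit z e (edgeMap (τ.trans τ₀.symm) e) := by
  classical
  rw [edgeOverlap, card_filter, ← sum_coe_sort (pairs n), edgesIn, sum_filter]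
  push_cast
  refine sum_congr rfl fun e _ => ?_
  have h : (relabel τ₀ fun e => (z e).2).Adj (τ e.1.1) (τ e.1.2) ↔
      (z (edgeMap (τ.trans τ₀.symm) e)).2 := by
    rw [relabel_adj]
    refine Iff.trans ?_ (toGraph_adj_edge (fun e => (z e).2) _)
    exact (adj_edgeMap _ (τ.trans τ₀.symm) e).symm
  simp only [imageAdj_restrict, toGraph_adj_edge, h, hit]
  by_cases he : e.1.1 ∈ S ∧ e.1.2 ∈ S <;> simp [he]

theorem sum_edgeLaw_fst {S : Finset (Fin n)} (e : Edge n) :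
    ∑ a, edgeLaw p ρ S e a * (open Classical in if a.1 then 1 else 0) = p := by
  rw [sum_prop_prod]
  simp [edgeLaw, bernPair]
  ring

theorem sum_edgeLaw_snd {S : Finset (Fin n)} (e : Edge n) :
    ∑ a, edgeLaw p ρ S e a * (open Classical in if a.2 then 1 else 0) = p := by
  rw [sum_prop_prod]
  simp [edgeLaw, bernPair]
  ring

theorem sum_edgeLaw_and (hp : 0 < p) {S : Finset (Fin n)} (e : Edge n) :
    ∑ a, edgeLaw p ρ S e a * (open Classical in if a.1 ∧ a.2 then 1 else 0) =
      open Classical in if e ∈ edgesIn S then p ^ 2 * (1 + signal p ρ) else p ^ 2 := by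
  rw [sum_prop_prod]
  simp only [edgeLaw, edgeCorr, bernPair]
  split_ifs <;> simp_all [bernPair_true]

theorem prodExp_hit_le (hp : 0 < p) (hp2 : p ≤ 1 / 2) (hρ : 0 < ρ) {S : Finset (Fin n)}
    (e e' : Edge n) :
    prodExp (edgeLaw p ρ S) (fun z => hit z e e') ≤
      p ^ 2 + open Classical in if e' = e ∧ e ∈ edgesIn S then p ^ 2 * (1 + signal p ρ) else 0 := by
  classical
  have hγ := signal_pos hp hp2 hρ
  by_cases h : e' = e
  · subst h
    have h1 : prodExp (edgeLaw p ρ S) (fun z => hit z e' e') = _ :=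
      prodExp_coord sum_edgeLaw e' (fun a => if a.1 ∧ a.2 then 1 else 0)
    rw [h1, sum_edgeLaw_and hp]
    by_cases h2 : e' ∈ edgesIn S
    · simp only [h2, if_true, and_self]
      have : 0 < p ^ 2 := by positivity
      linarith
    · simp [h2]
  · have h1 : prodExp (edgeLaw p ρ S) (fun z => hit z e e') = p * p := by
      have := prodExp_coord_mul (w := edgeLaw p ρ S) sum_edgeLaw (Ne.symm h)
        (fun a => if a.1 then 1 else 0) (fun a => if a.2 then 1 else 0)
      rw [sum_edgeLaw_fst, sum_edgeLaw_snd] at this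
      rw [← this]
      congr 1
      funext z
      by_cases h3 : (z e).1 <;> by_cases h4 : (z e').2 <;> simp [hit, h3, h4]
    rw [h1]
    simp [h, pow_two]

theorem exp_mul_hit (t : ℝ) (z : Edge n → Prop × Prop) (e e' : Edge n) :
    Real.exp (t * hit z e e') = 1 + (Real.exp t - 1) * hit z e e' := by
  unfold hit
  split_ifs <;> simp

theorem prodExp_exp_neg_matched_le (hp : 0 < p) (hp2 : p ≤ 1 / 2) (hρ : 0 < ρ) (hρ1 : ρ < 1)
    {S : Finset (Fin n)} {T : Finset (Edge n)} (hT : T ⊆ edgesIn S) (s : ℝ) :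
    prodExp (edgeLaw p ρ S) (fun z => Real.exp (-s * ∑ e ∈ T, hit z e e)) ≤
      Real.exp (-(#T * (p ^ 2 * (1 + signal p ρ)) * (1 - Real.exp (-s)))) := by
  classical
  set q := p ^ 2 * (1 + signal p ρ)
  have h1 : ∀ z : Edge n → Prop × Prop, Real.exp (-s * ∑ e ∈ T, hit z e e) =
      ∏ e, if e ∈ T then 1 + (Real.exp (-s) - 1) * (if (z e).1 ∧ (z e).2 then 1 else 0) else 1 := by
    intro z
    rw [mul_sum, Real.exp_sum, ← prod_filter, filter_mem_eq_inter, univ_inter]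
    refine prod_congr rfl fun e _ => ?_
    rw [exp_mul_hit]
    rfl
  simp only [h1]
  rw [prodExp_prod (edgeLaw p ρ S) (fun e a =>
    if e ∈ T then 1 + (Real.exp (-s) - 1) * (if a.1 ∧ a.2 then 1 else 0) else 1)]
  have h2 : ∀ e : Edge n, ∑ a, edgeLaw p ρ S e a *
      (if e ∈ T then 1 + (Real.exp (-s) - 1) * (if a.1 ∧ a.2 then 1 else 0) else 1) ≤
      if e ∈ T then Real.exp (-(q * (1 - Real.exp (-s)))) else 1 := by
    intro e
    split_ifs with he
    · have h3 := sum_edgeLaw_and (ρ := ρ) (S := S) hp e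
      rw [if_pos (hT he)] at h3
      simp only [mul_add, mul_one, sum_add_distrib, sum_edgeLaw, mul_left_comm _ (Real.exp (-s) - 1),
        ← mul_sum, h3]
      refine le_trans (le_of_eq ?_) (Real.add_one_le_exp _)
      ring
    · simp [sum_edgeLaw]
  refine (prod_le_prod (fun e _ => sum_nonneg fun a _ =>
    mul_nonneg (edgeLaw_pos hp hp2 hρ.le hρ1 e a).le ?_) fun e _ => h2 e).trans (le_of_eq ?_)
  · have := Real.exp_pos (-s)
    split_ifs <;> linarith
  · rw [← prod_filter, filter_mem_eq_inter, univ_inter, prod_const, ← Real.exp_nat_mul]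
    congr 1
    ring

/-- An edge fixed by `σ` has its endpoints either both fixed, which would put it inside `F`, or
swapped; a swapped edge is determined by its first endpoint. -/
theorem card_swapped_le (σ : Equiv.Perm (Fin n)) {S S₀ F : Finset (Fin n)}
    (hF : ∀ v, v ∈ S₀ → v ∈ S → σ v = v → v ∈ F) (U : Finset (Edge n))
    (hU : ∀ e ∈ U, e ∈ edgesIn S ∧ e ∉ edgesIn F ∧ edgeMap σ e = e ∧ e ∈ edgesIn S₀) :
    #U ≤ #S := by
  have hswap : ∀ e ∈ U, σ e.1.1 = e.1.2 := by
    intro e he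
    obtain ⟨h1, h2, h3, h4⟩ := hU e he
    rw [mem_edgesIn] at h1 h4
    have h5 := mkEdge_fst_snd (σ e.1.1) (σ e.1.2) (σ.injective.ne e.lt.ne)
    rw [show mkEdge (σ e.1.1) (σ e.1.2) (σ.injective.ne e.lt.ne) = e from h3] at h5
    rcases h5 with ⟨h6, h7⟩ | ⟨h6, h7⟩
    · exact absurd (mem_edgesIn.2 ⟨hF _ h4.1 h1.1 h6.symm, hF _ h4.2 h1.2 h7.symm⟩) h2
    · exact h7.symm
  refine card_le_card_of_injOn (fun e => e.1.1) (fun e he => (mem_edgesIn.1 (hU e he).1).1) ?_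
  intro e he e' he' h
  refine Subtype.ext (Prod.ext h ?_)
  rw [← hswap e he, ← hswap e' he']
  exact congrArg σ h

/-- Coordinate `i` enters only the factors of `i` and `edgeMap σ.symm i`, so Finner's inequality
applies: squaring turns `t` into `2 * t` and the root gives the factor `1 / 2`. Only edges fixed by
`σ` inside `S₀` feel the correlation, and `card_swapped_le` bounds their number. -/
theorem prodExp_exp_mismatched_le (hp : 0 < p) (hp2 : p ≤ 1 / 2) (hρ : 0 < ρ) (hρ1 : ρ < 1)
    (σ : Equiv.Perm (Fin n)) {S S₀ F : Finset (Fin n)}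
    (hF : ∀ v, v ∈ S₀ → v ∈ S → σ v = v → v ∈ F) {t : ℝ} (ht : 0 ≤ t) :
    prodExp (edgeLaw p ρ S₀)
      (fun z => Real.exp (t * ∑ e ∈ edgesIn S \ edgesIn F, hit z e (edgeMap σ e))) ≤
      Real.exp ((Real.exp (2 * t) - 1) / 2 * (#(edgesIn S \ edgesIn F) * p ^ 2 +
        #S * (p ^ 2 * (1 + signal p ρ)))) := by
  classical
  set T := edgesIn S \ edgesIn F with hT
  set q := p ^ 2 * (1 + signal p ρ)
  have hγ := signal_pos hp hp2 hρ
  have hq : 0 ≤ q := by positivity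
  have hx : 0 ≤ Real.exp (2 * t) - 1 := by
    have := Real.add_one_le_exp (2 * t)
    linarith
  have h1 : ∀ z : Edge n → Prop × Prop, Real.exp (t * ∑ e ∈ T, hit z e (edgeMap σ e)) =
      ∏ e, if e ∈ T then Real.exp (t * hit z e (edgeMap σ e)) else 1 := by
    intro z
    rw [mul_sum, Real.exp_sum, ← prod_filter, filter_mem_eq_inter, univ_inter]
  simp only [h1]
  refine (prodExp_prod_le_prod_sqrt (edgeLaw p ρ S₀)
    (fun e a => (edgeLaw_pos hp hp2 hρ.le hρ1 e a).le) sum_edgeLaw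
    (fun i j => i = j ∨ i = edgeMap σ j)
    (fun e z => if e ∈ T then Real.exp (t * hit z e (edgeMap σ e)) else 1) ?_ ?_ ?_).trans ?_
  · intro e z
    split_ifs
    · exact (Real.exp_pos _).le
    · exact zero_le_one
  · intro e z z' h
    simp only [hit, h e (Or.inl rfl), h (edgeMap σ e) (Or.inr rfl)]
  · intro i
    refine ⟨{i, edgeMap σ.symm i}, card_le_two, ?_⟩
    rintro j (rfl | rfl)
    · simp
    · simp [edgeMap_symm_edgeMap]
  · have h2 : ∀ e : Edge n, √(prodExp (edgeLaw p ρ S₀)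
        (fun z => (if e ∈ T then Real.exp (t * hit z e (edgeMap σ e)) else 1) ^ 2)) ≤
        Real.exp ((Real.exp (2 * t) - 1) / 2 * ((if e ∈ T then p ^ 2 else 0) +
          if e ∈ T ∧ edgeMap σ e = e ∧ e ∈ edgesIn S₀ then q else 0)) := by
      intro e
      rw [Real.sqrt_le_left (Real.exp_pos _).le, ← Real.exp_nat_mul]
      by_cases he : e ∈ T
      · have h3 : ∀ z : Edge n → Prop × Prop, Real.exp (t * hit z e (edgeMap σ e)) ^ 2 =
            1 + (Real.exp (2 * t) - 1) * hit z e (edgeMap σ e) := by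
          intro z
          rw [← exp_mul_hit, ← Real.exp_nat_mul]
          congr 1
          push_cast
          ring
        simp only [he, if_true, true_and, h3]
        rw [prodExp_add, prodExp_one sum_edgeLaw, prodExp_const_mul]
        have h4 := mul_le_mul_of_nonneg_left
          (prodExp_hit_le hp hp2 hρ (S := S₀) e (edgeMap σ e)) hx
        refine le_trans ?_ (Real.add_one_le_exp _)
        push_cast
        linarith
      · simp [he, prodExp_one sum_edgeLaw]
    refine (prod_le_prod (fun e _ => Real.sqrt_nonneg _) fun e _ => h2 e).trans ?_
    rw [← Real.exp_sum, Real.exp_le_exp, ← mul_sum, sum_add_distrib, ← sum_filter, ← sum_filter,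
      filter_mem_eq_inter, univ_inter, sum_const, sum_const, nsmul_eq_mul, nsmul_eq_mul]
    have h5 : #({e | e ∈ T ∧ edgeMap σ e = e ∧ e ∈ edgesIn S₀} : Finset (Edge n)) ≤ #S := by
      refine card_swapped_le σ hF _ fun e he => ?_
      simp only [mem_filter, mem_univ, true_and, hT, mem_sdiff] at he
      exact ⟨he.1.1, he.1.2, he.2⟩
    have h6 : (#({e | e ∈ T ∧ edgeMap σ e = e ∧ e ∈ edgesIn S₀} : Finset (Edge n)) : ℝ) ≤ #S := by
      exact_mod_cast h5
    gcongr

/-- Lower tail of the number of common edges, at the threshold `N p² (1 + γ / 2)`. -/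
theorem prodExp_lower_tail_le (hp : 0 < p) (hp2 : p ≤ 1 / 2) (hρ : 0 < ρ) (hρ1 : ρ < 1)
    {S : Finset (Fin n)} {T : Finset (Edge n)} (hT : T ⊆ edgesIn S) :
    prodExp (edgeLaw p ρ S) (fun z => Real.exp (signal p ρ / (2 * (1 + signal p ρ)) *
      (#T * (p ^ 2 * (1 + signal p ρ / 2)) - ∑ e ∈ T, hit z e e))) ≤
      Real.exp (-(#T * (p ^ 2 * (signal p ρ ^ 2 / (1 + signal p ρ))) / 8)) := by
  have hγ := signal_pos hp hp2 hρ
  have h1 := prodExp_exp_neg_matched_le hp hp2 hρ hρ1 hT (signal p ρ / (2 * (1 + signal p ρ)))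
  set γ := signal p ρ
  set s := γ / (2 * (1 + γ)) with hs
  have hs0 : 0 ≤ s := by positivity
  have h2 : ∀ z : Edge n → Prop × Prop,
      Real.exp (s * (#T * (p ^ 2 * (1 + γ / 2)) - ∑ e ∈ T, hit z e e)) =
      Real.exp (s * (#T * (p ^ 2 * (1 + γ / 2)))) * Real.exp (-s * ∑ e ∈ T, hit z e e) := by
    intro z
    rw [← Real.exp_add]
    congr 1
    ring
  simp only [h2]
  rw [prodExp_const_mul]
  refine (mul_le_mul_of_nonneg_left h1 (Real.exp_pos _).le).trans ?_
  rw [← Real.exp_add, Real.exp_le_exp]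
  -- This bounds the exponent per edge by a quadratic in `s`, minimal exactly at `s = γ / (2 (1 +
  -- γ))`.
  have h3 := exp_neg_le hs0
  have h4 : s * (1 + γ / 2) - (1 + γ) * (s - s ^ 2 / 2) = -(γ ^ 2 / (1 + γ) / 8) := by
    rw [hs]
    field_simp
    ring
  have h5 : s * (1 + γ / 2) - (1 + γ) * (1 - Real.exp (-s)) ≤ -(γ ^ 2 / (1 + γ) / 8) := by
    rw [← h4]
    have : (1 + γ) * (s - s ^ 2 / 2) ≤ (1 + γ) * (1 - Real.exp (-s)) := by
      refine mul_le_mul_of_nonneg_left (by linarith) (by linarith)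
    linarith
  have h6 : (0 : ℝ) ≤ #T * p ^ 2 := by positivity
  have := mul_le_mul_of_nonneg_left h5 h6
  linarith

/-- Upper tail of the number of spurious common edges, at the threshold `N p² (1 + γ / 2)`. -/
theorem prodExp_upper_tail_le (hp : 0 < p) (hp2 : p ≤ 1 / 2) (hρ : 0 < ρ) (hρ1 : ρ < 1)
    (σ : Equiv.Perm (Fin n)) {S S₀ F : Finset (Fin n)}
    (hF : ∀ v, v ∈ S₀ → v ∈ S → σ v = v → v ∈ F) :
    prodExp (edgeLaw p ρ S₀)
      (fun z => Real.exp (Real.log (1 + signal p ρ / 2) / 2 *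
        ((∑ e ∈ edgesIn S \ edgesIn F, hit z e (edgeMap σ e)) -
          #(edgesIn S \ edgesIn F) * (p ^ 2 * (1 + signal p ρ / 2))))) ≤
      Real.exp (-(#(edgesIn S \ edgesIn F) * (p ^ 2 * phi (signal p ρ)) / 16) + #S / 4) := by
  have hγ := signal_pos hp hp2 hρ
  have hle := mul_one_add_signal_le hp hp2 hρ1
  have h1 := prodExp_exp_mismatched_le hp hp2 hρ hρ1 σ hF
    (t := Real.log (1 + signal p ρ / 2) / 2)
    (div_nonneg (Real.log_nonneg (by linarith)) two_pos.le)
  rw [mul_div_cancel₀ _ two_ne_zero, Real.exp_log (by linarith)] at h1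
  set T := edgesIn S \ edgesIn F
  have h7 := phi_le_eight_mul_phi_half hγ.le
  set γ := signal p ρ
  set t := Real.log (1 + γ / 2) / 2 with ht
  have h2 : ∀ z : Edge n → Prop × Prop,
      Real.exp (t * ((∑ e ∈ T, hit z e (edgeMap σ e)) - #T * (p ^ 2 * (1 + γ / 2)))) =
      Real.exp (-(t * (#T * (p ^ 2 * (1 + γ / 2))))) *
        Real.exp (t * ∑ e ∈ T, hit z e (edgeMap σ e)) := by
    intro z
    rw [← Real.exp_add]
    congr 1
    ring
  simp only [h2]
  rw [prodExp_const_mul]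
  refine (mul_le_mul_of_nonneg_left h1 (Real.exp_pos _).le).trans ?_
  rw [← Real.exp_add, Real.exp_le_exp]
  -- The swapped edges contribute `(γ / 4) #S p² (1 + γ)`, at most `#S / 4`.
  have h8 : (#S : ℝ) * ((p * γ) * (p * (1 + γ))) ≤ #S * 1 := by
    refine mul_le_mul_of_nonneg_left (mul_le_one₀ (by nlinarith) (by positivity) hle) (by positivity)
  have h9 : (#T : ℝ) * p ^ 2 * phi γ ≤ #T * p ^ 2 * (8 * phi (γ / 2)) := by gcongr
  have h10 : #T * p ^ 2 * phi (γ / 2) =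
      2 * (t * (#T * (p ^ 2 * (1 + γ / 2)))) - #T * p ^ 2 * (γ / 2) := by
    rw [ht, phi]
    ring
  linarith

theorem two_mul_card_edgesIn_real (S : Finset (Fin n)) :
    2 * (#(edgesIn S) : ℝ) = #S * (#S - 1) := by
  have h := two_mul_card_edgesIn S
  rcases Nat.eq_zero_or_pos #S with h0 | h0
  · rw [h0] at h ⊢
    have : #(edgesIn S) = 0 := by omega
    simp [this]
  · have h1 : ((#S - 1 : ℕ) : ℝ) = #S - 1 := by
      rw [Nat.cast_sub h0, Nat.cast_one]
    rw [← h1]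
    exact_mod_cast h

theorem card_edgesIn_sdiff_ge {S F : Finset (Fin n)} (hFS : F ⊆ S) {δ : ℝ} (hδ1 : δ < 1)
    (hF : (#F : ℝ) ≤ δ * #S) (hS : 2 ≤ #S) :
    (1 - δ) * (#S : ℝ) ^ 2 / 4 ≤ #(edgesIn S \ edgesIn F) := by
  have h1 := two_mul_card_edgesIn_real S
  have h2 := two_mul_card_edgesIn_real F
  have hSR : (2 : ℝ) ≤ #S := by exact_mod_cast hS
  have hFR : (#F : ℝ) ≤ #S := by exact_mod_cast card_le_card hFS
  rw [cast_card_sdiff (edgesIn_mono hFS)]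
  have h3 : (#F : ℝ) * (#F - 1) ≤ δ * #S * (#S - 1) := by
    have h4 : (#F : ℝ) * (#F - 1) ≤ #F * (#S - 1) := by gcongr
    have h5 : (#F : ℝ) * (#S - 1) ≤ δ * #S * (#S - 1) := by
      refine mul_le_mul_of_nonneg_right hF (by linarith)
    linarith
  have h6 : (0 : ℝ) ≤ (1 - δ) * #S * (#S - 2) :=
    mul_nonneg (mul_nonneg (by linarith) (by linarith)) (by linarith)
  nlinarith

theorem mem_agreement_restrict {τ₀ τ : Equiv.Perm (Fin n)} {S₀ S : Finset (Fin n)} {v : Fin n} :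
    v ∈ agreement (restrict τ₀ S₀) (restrict τ S) ↔ v ∈ S₀ ∧ v ∈ S ∧ τ v = τ₀ v := by
  simp only [agreement, restrict_eq_some, mem_filter, mem_univ, true_and]
  constructor
  · rintro ⟨w, ⟨h1, h2⟩, h3, h4⟩
    exact ⟨h1, h3, h4.trans h2.symm⟩
  · rintro ⟨h1, h2, h3⟩
    exact ⟨_, ⟨h1, rfl⟩, h2, h3⟩

/-- The overlap of two injections splits into the common part and the remaining edges. -/
theorem edgeOverlap_eq_add (τ₀ τ : Equiv.Perm (Fin n)) {S F : Finset (Fin n)} (hFS : F ⊆ S)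
    (hF : ∀ v ∈ F, τ v = τ₀ v) (z : Edge n → Prop × Prop) :
    (edgeOverlap (restrict τ S) (toGraph fun e => (z e).1) (relabel τ₀ fun e => (z e).2) : ℝ) =
      ∑ e ∈ edgesIn F, hit z e e +
        ∑ e ∈ edgesIn S \ edgesIn F, hit z e (edgeMap (τ.trans τ₀.symm) e) := by
  rw [edgeOverlap_restrict, ← sum_sdiff (edgesIn_mono hFS), add_comm]
  congr 1
  refine sum_congr rfl fun e he => ?_
  rw [mem_edgesIn] at he
  congr 1
  simp only [edgeMap, Equiv.trans_apply, hF _ he.1, hF _ he.2, Equiv.symm_apply_apply, mkEdge_self]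

theorem edgeMap_refl (τ : Equiv.Perm (Fin n)) (e : Edge n) :
    edgeMap (τ.trans τ.symm) e = e := by
  simp [edgeMap, mkEdge_self]

theorem prob_overlap_lt_le {c δ : ℝ} (hδ : 0 < δ) (hδ1 : δ < 1) (hc : 384 ≤ (1 - δ) * c)
    (hp : 0 < p) (hnp : 1 / (n : ℝ) ≤ p) (hp2 : p ≤ 1 / 2) (hρ : 0 < ρ) (hρ1 : ρ < 1)
    (hn : 1 ≤ Real.log n)
    (h : c * Real.log n / (p ^ 2 * phi (signal p ρ)) ≤ m) {est : Estimator n}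
    (hest : MaximizesEdgeOverlap m est) {π₀ : PartialMap n} (hπ₀ : π₀ ∈ injections n m) :
    prob p ρ π₀ (fun G₁ G₂ => overlap π₀ (est G₁ G₂) < δ) ≤ 2 * Real.exp (-Real.log n) := by
  classical
  obtain ⟨τ₀, S₀, hS₀, rfl⟩ := exists_restrict_eq hπ₀
  have hγ := signal_pos hp hp2 hρ
  have hV : 0 < p ^ 2 * phi (signal p ρ) := mul_pos (by positivity) (phi_pos hγ)
  have hV1 := sq_mul_phi_le_one hp hp2 hρ hρ1
  have hc' : 384 ≤ c := by nlinarith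
  have hnR : (0 : ℝ) < n := by
    rcases Nat.eq_zero_or_pos n with h0 | h0
    · rw [h0] at hn
      norm_num at hn
    · exact_mod_cast h0
  have hpn : -Real.log p ≤ Real.log n := by
    rw [← Real.log_inv]
    refine Real.log_le_log (inv_pos.2 hp) ?_
    rwa [inv_le_comm₀ hp hnR, ← one_div]
  rw [div_le_iff₀ hV] at h
  have hphi := phi_signal_le hn hp hp2 hρ hρ1 hpn
  set γ := signal p ρ
  set V := p ^ 2 * phi γ
  set L := Real.log n
  set R := p ^ 2 * (γ ^ 2 / (1 + γ)) with hR
  have hmL : c * L ≤ m := h.trans (mul_le_of_le_one_right (by positivity) hV1)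
  have hm384 : (384 : ℝ) ≤ m := by nlinarith
  have hm2 : 2 ≤ m := by
    have : (2 : ℝ) ≤ m := by linarith
    exact_mod_cast this
  have hmR : c / 2 ≤ m * R := by
    have h1 : V ≤ 2 * R * L := by
      have := mul_le_mul_of_nonneg_left hphi (sq_nonneg p)
      rw [hR]
      linarith
    have h2 : (m : ℝ) * V ≤ m * (2 * R * L) := by gcongr
    have h3 : c * L ≤ 2 * (m * R) * L := by linarith
    linarith [le_of_mul_le_mul_right h3 (by linarith)]
  set s := γ / (2 * (1 + γ))
  set t := Real.log (1 + γ / 2) / 2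
  have hs : 0 ≤ s := by positivity
  have ht : 0 ≤ t := div_nonneg (Real.log_nonneg (by linarith)) two_pos.le
  set thr : Finset (Fin n) → ℝ := fun F => #(edgesIn S₀ \ edgesIn F) * (p ^ 2 * (1 + γ / 2))
  set sets := S₀.powerset.filter fun F => (#F : ℝ) ≤ δ * m
  set maps := (injections n m).filter fun π => overlap (restrict τ₀ S₀) π < δ
  set X : Finset (Fin n) → (Edge n → Prop × Prop) → ℝ := fun F z =>
    ∑ e ∈ edgesIn S₀ \ edgesIn F, hit z e e
  set Y : PartialMap n → (Edge n → Prop × Prop) → ℝ := fun π z =>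
    (edgeOverlap π (toGraph fun e => (z e).1) (relabel τ₀ fun e => (z e).2) : ℝ) -
      ∑ e ∈ edgesIn (agreement (restrict τ₀ S₀) π), hit z e e
  have hagree : ∀ π ∈ maps, agreement (restrict τ₀ S₀) π ∈ sets := by
    intro π hπ
    simp only [maps, mem_filter, overlap_eq hπ₀] at hπ
    simp only [sets, mem_filter, mem_powerset]
    refine ⟨fun v hv => ?_, ?_⟩
    · simp only [agreement, mem_filter, mem_univ, true_and, restrict_eq_some] at hv
      obtain ⟨w, hw, -⟩ := hv
      exact hw.1
    · have h1 := hπ.2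
      rw [div_lt_iff₀ (by linarith)] at h1
      exact h1.le
  -- When the estimator fails, `X F z ≤ Y π z` for its output `π`, so one of the two counts lies on
  -- the wrong side of `thr F` and its exponential is at least `1`.
  have hpoint : ∀ z : Edge n → Prop × Prop,
      (if overlap (restrict τ₀ S₀) (est (toGraph fun e => (z e).1) (relabel τ₀ fun e => (z e).2)) < δ
        then (1 : ℝ) else 0) ≤
      ∑ F ∈ sets, Real.exp (s * (thr F - X F z)) +
        ∑ π ∈ maps, Real.exp (t * (Y π z - thr (agreement (restrict τ₀ S₀) π))) := by
    intro z
    have h0 : 0 ≤ ∑ F ∈ sets, Real.exp (s * (thr F - X F z)) :=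
      sum_nonneg fun _ _ => (Real.exp_pos _).le
    have h0' : 0 ≤ ∑ π ∈ maps, Real.exp (t * (Y π z - thr (agreement (restrict τ₀ S₀) π))) :=
      sum_nonneg fun _ _ => (Real.exp_pos _).le
    split_ifs with hbad
    · obtain ⟨hmem, hmax⟩ := hest (toGraph fun e => (z e).1) (relabel τ₀ fun e => (z e).2)
      have hmax := hmax _ hπ₀
      set π := est (toGraph fun e => (z e).1) (relabel τ₀ fun e => (z e).2)
      have hπ : π ∈ maps := mem_filter.2 ⟨hmem, hbad⟩
      have hFs := hagree π hπ
      set F := agreement (restrict τ₀ S₀) π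
      have hXY : X F z ≤ Y π z := by
        have h1 := edgeOverlap_eq_add τ₀ τ₀ (mem_powerset.1 (mem_filter.1 hFs).1)
          (fun _ _ => rfl) z
        simp only [edgeMap_refl] at h1
        have h2 : ((edgeOverlap (restrict τ₀ S₀) (toGraph fun e => (z e).1)
          (relabel τ₀ fun e => (z e).2) : ℕ) : ℝ) ≤ (edgeOverlap π (toGraph fun e => (z e).1)
          (relabel τ₀ fun e => (z e).2) : ℕ) := Nat.cast_le.2 hmax
        simp only [X, Y]
        linarith
      rcases le_total (X F z) (thr F) with hle | hle
      · have h1 : 1 ≤ Real.exp (s * (thr F - X F z)) :=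
          Real.one_le_exp (mul_nonneg hs (by linarith))
        have h2 := single_le_sum (f := fun F => Real.exp (s * (thr F - X F z)))
          (fun _ _ => (Real.exp_pos _).le) hFs
        linarith
      · have h1 : 1 ≤ Real.exp (t * (Y π z - thr F)) :=
          Real.one_le_exp (mul_nonneg ht (by linarith))
        have h2 := single_le_sum
          (f := fun π => Real.exp (t * (Y π z - thr (agreement (restrict τ₀ S₀) π))))
          (fun _ _ => (Real.exp_pos _).le) hπ
        linarith
    · linarith
  have hN : ∀ F ∈ sets, (1 - δ) * (m : ℝ) ^ 2 / 4 ≤ #(edgesIn S₀ \ edgesIn F) := by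
    intro F hF
    simp only [sets, mem_filter, mem_powerset] at hF
    rw [← hS₀] at hF hm2 ⊢
    exact card_edgesIn_sdiff_ge hF.1 hδ1 hF.2 hm2
  -- By `hN` and `hmR` the exponent is at least `(1 - δ) c m / 64 ≥ 6 m`, whence `384 = 6 * 64`;
  -- this beats the `exp m` sets.
  have hlower : ∀ F ∈ sets, prodExp (edgeLaw p ρ S₀)
      (fun z => Real.exp (s * (thr F - X F z))) ≤ Real.exp (-(6 * m)) := by
    intro F hF
    refine (prodExp_lower_tail_le hp hp2 hρ hρ1 sdiff_subset).trans (Real.exp_le_exp.2 ?_)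
    have h1 : (1 - δ) * (m : ℝ) ^ 2 / 4 * R ≤ #(edgesIn S₀ \ edgesIn F) * R :=
      mul_le_mul_of_nonneg_right (hN F hF) (by positivity)
    have h2 : (1 - δ) * m * (c / 2) ≤ (1 - δ) * m * (m * R) :=
      mul_le_mul_of_nonneg_left hmR (mul_nonneg (by linarith) (by linarith))
    have h3 : (m : ℝ) * 384 ≤ m * ((1 - δ) * c) := by gcongr
    linarith
  -- The same constant gives `6 m L`; the loss `m / 4` leaves at least `5 m L`, against at most `exp
  -- (2 m L)` maps.
  have hupper : ∀ π ∈ maps, prodExp (edgeLaw p ρ S₀)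
      (fun z => Real.exp (t * (Y π z - thr (agreement (restrict τ₀ S₀) π)))) ≤
      Real.exp (-(5 * m * L)) := by
    intro π hπ
    have hF := hagree π hπ
    have hNF := hN _ hF
    obtain ⟨τ, S, hS, rfl⟩ := exists_restrict_eq (mem_filter.1 hπ).1
    have hag : ∀ v, v ∈ agreement (restrict τ₀ S₀) (restrict τ S) ↔ v ∈ S₀ ∧ v ∈ S ∧ τ v = τ₀ v :=
      fun v => mem_agreement_restrict
    set F := agreement (restrict τ₀ S₀) (restrict τ S)
    have hFS : F ⊆ S := fun v hv => ((hag v).1 hv).2.1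
    have hcard : #(edgesIn S₀ \ edgesIn F) = #(edgesIn S \ edgesIn F) := by
      have hFS₀ := mem_powerset.1 (mem_filter.1 hF).1
      have h1 := two_mul_card_edgesIn S₀
      have h2 := two_mul_card_edgesIn S
      rw [hS₀] at h1
      rw [hS] at h2
      rw [card_sdiff_of_subset (edgesIn_mono hFS), card_sdiff_of_subset (edgesIn_mono hFS₀)]
      omega
    have hY : ∀ z, Y (restrict τ S) z =
        ∑ e ∈ edgesIn S \ edgesIn F, hit z e (edgeMap (τ.trans τ₀.symm) e) := by
      intro z
      have h1 := edgeOverlap_eq_add τ₀ τ hFS (fun v hv => ((hag v).1 hv).2.2) z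
      simp only [Y]
      linarith
    simp only [hY, thr, hcard]
    refine (prodExp_upper_tail_le hp hp2 hρ hρ1 (τ.trans τ₀.symm) (S := S) (F := F) ?_).trans
      (Real.exp_le_exp.2 ?_)
    · intro v h1 h2 h3
      exact (hag v).2 ⟨h1, h2, (Equiv.symm_apply_eq _).1 h3⟩
    · rw [← hcard, hS]
      have h1 : (1 - δ) * (m : ℝ) ^ 2 / 4 * V ≤ #(edgesIn S₀ \ edgesIn F) * V :=
        mul_le_mul_of_nonneg_right hNF hV.le
      have h2 : (1 - δ) * m * (c * L) ≤ (1 - δ) * m * (m * V) :=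
        mul_le_mul_of_nonneg_left h (mul_nonneg (by linarith) (by linarith))
      have h3 : (m : ℝ) * L * 384 ≤ m * L * ((1 - δ) * c) := by gcongr
      have h4 : (m : ℝ) * 1 ≤ m * L := by gcongr
      show -(#(edgesIn S₀ \ edgesIn F) * V / 16) + (m : ℝ) / 4 ≤ -(5 * m * L)
      linarith
  have hsets : (#sets : ℝ) ≤ Real.exp m := by
    have h1 : #sets ≤ 2 ^ m := by
      rw [← hS₀, ← card_powerset]
      exact card_filter_le _ _
    have h2 : (2 : ℝ) ^ m ≤ Real.exp 1 ^ m := by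
      gcongr
      linarith [Real.add_one_le_exp 1]
    rw [← Real.exp_nat_mul, mul_one] at h2
    exact le_trans (by exact_mod_cast h1) h2
  have hmaps : (#maps : ℝ) ≤ Real.exp (2 * m * L) := by
    have h1 : #maps ≤ (n * n) ^ m := (card_filter_le _ _).trans card_injections_le
    have h2 : Real.exp (2 * m * L) = ((n : ℝ) * n) ^ m := by
      rw [show 2 * m * L = m * (L + L) by ring, Real.exp_nat_mul, Real.exp_add, Real.exp_log hnR]
    rw [h2]
    exact_mod_cast h1
  rw [prob_restrict]
  refine (prodExp_mono (fun e a => (edgeLaw_pos hp hp2 hρ.le hρ1 e a).le) hpoint).trans ?_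
  rw [prodExp_add, prodExp_sum, prodExp_sum]
  have hA : ∑ F ∈ sets, prodExp (edgeLaw p ρ S₀) (fun z => Real.exp (s * (thr F - X F z))) ≤
      Real.exp (-L) := by
    refine (sum_le_card_nsmul _ _ _ hlower).trans ?_
    rw [nsmul_eq_mul]
    refine (mul_le_mul_of_nonneg_right hsets (Real.exp_pos _).le).trans ?_
    rw [← Real.exp_add, Real.exp_le_exp]
    nlinarith
  have hB : ∑ π ∈ maps, prodExp (edgeLaw p ρ S₀)
      (fun z => Real.exp (t * (Y π z - thr (agreement (restrict τ₀ S₀) π)))) ≤ Real.exp (-L) := by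
    refine (sum_le_card_nsmul _ _ _ hupper).trans ?_
    rw [nsmul_eq_mul]
    refine (mul_le_mul_of_nonneg_right hmaps (Real.exp_pos _).le).trans ?_
    rw [← Real.exp_add, Real.exp_le_exp]
    nlinarith
  linarith

theorem exists_maximizesEdgeOverlap (h : m ≤ n) : ∃ est : Estimator n, MaximizesEdgeOverlap m est := by
  have hex : ∀ G₁ G₂ : SimpleGraph (Fin n), ∃ π ∈ injections n m,
      ∀ π' ∈ injections n m, edgeOverlap π' G₁ G₂ ≤ edgeOverlap π G₁ G₂ :=
    fun G₁ G₂ => exists_max_image _ (fun π => edgeOverlap π G₁ G₂) (injections_nonempty h)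
  choose est hest using hex
  exact ⟨est, hest⟩

end Possibility

theorem exists_forall_le_log (x : ℝ) : ∃ N : ℕ, ∀ n : ℕ, N ≤ n → x ≤ Real.log n := by
  have h := (Real.tendsto_log_atTop.comp tendsto_natCast_atTop_atTop).eventually_ge_atTop x
  exact Filter.eventually_atTop.1 h

end PartialER

end

theorem theorem1 :
    -- edge overlap maximizers exist
    (∀ n m : ℕ, m ≤ n → ∃ est : PartialER.Estimator n, PartialER.MaximizesEdgeOverlap m est) ∧
    -- possibility: every edge overlap maximizer works, uniformly over the latent injection
    (∀ δ : ℝ, 0 < δ → δ < 1 → ∃ c₁ : ℝ, 0 < c₁ ∧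
      ∀ ε : ℝ, 0 < ε → ∃ N : ℕ, ∀ n : ℕ, N ≤ n → ∀ m : ℕ, m ≤ n → ∀ p ρ : ℝ,
        0 < p → 1 / (n : ℝ) ≤ p → p ≤ 1 / 2 → 0 < ρ → ρ < 1 →
        c₁ * Real.log n / (p ^ 2 * PartialER.phi (PartialER.signal p ρ)) ≤ m →
        ∀ est : PartialER.Estimator n, PartialER.MaximizesEdgeOverlap m est →
        ∀ π ∈ PartialER.injections n m,
          1 - ε ≤ PartialER.prob p ρ π
            (fun G₁ G₂ => δ ≤ PartialER.overlap π (est G₁ G₂))) ∧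
    -- impossibility: every estimator fails when the latent injection is uniform
    (∀ c δ : ℝ, 0 < c → c < 1 → 0 < δ → δ < 1 → ∃ c₂ : ℝ, 0 < c₂ ∧
      ∃ N : ℕ, ∀ n : ℕ, N ≤ n → ∀ m : ℕ, m ≤ n → ∀ p ρ : ℝ,
        0 < p → 1 / (n : ℝ) ≤ p → p ≤ 1 / 2 → 0 < ρ → ρ < 1 →
        (m : ℝ) ≤ c₂ * Real.log n / (p ^ 2 * PartialER.phi (PartialER.signal p ρ)) →
        ∀ est : PartialER.Estimator n,
          1 - c ≤ PartialER.bayesProb n m p ρ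
            (fun π G₁ G₂ => PartialER.overlap π (est G₁ G₂) < δ)) := by
  refine ⟨fun n m h => PartialER.exists_maximizesEdgeOverlap h, ?_, ?_⟩
  · intro δ hδ hδ1
    have hδ' : 0 < 1 - δ := by linarith
    refine ⟨384 / (1 - δ), by positivity, fun ε hε => ?_⟩
    obtain ⟨N, hN⟩ := PartialER.exists_forall_le_log (max 1 (2 / ε))
    refine ⟨N, fun n hn m hmn p ρ hp hnp hp2 hρ hρ1 h est hest π hπ => ?_⟩
    have hlog := hN n hn
    have hbad := PartialER.prob_overlap_lt_le hδ hδ1 (mul_div_cancel₀ _ hδ'.ne').ge hp hnp hp2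
      hρ hρ1 ((le_max_left _ _).trans hlog) h hest hπ
    have hsum := PartialER.prob_add_prob_not hπ p ρ
      (fun G₁ G₂ => δ ≤ PartialER.overlap π (est G₁ G₂))
      (fun G₁ G₂ => PartialER.overlap π (est G₁ G₂) < δ) fun _ _ => not_le.symm
    have hexp : 2 * Real.exp (-Real.log n) ≤ ε := by
      have h1 := (le_max_right 1 (2 / ε)).trans hlog
      have h2 := Real.add_one_le_exp (Real.log n)
      rw [Real.exp_neg, ← div_eq_mul_inv, div_le_iff₀ (Real.exp_pos _), mul_comm]
      rw [← div_le_iff₀ hε]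
      linarith
    linarith
  · intro c δ hc _ hδ hδ1
    obtain ⟨N, hN⟩ := PartialER.exists_forall_le_log (max (8 / δ) (8 / (c * δ)))
    refine ⟨c * δ / 104, by positivity, N, fun n hn m hmn p ρ hp _ hp2 hρ hρ1 h est => ?_⟩
    have hlog := hN n hn
    exact PartialER.impossibility hc hδ hδ1 hmn hp hp2 hρ hρ1 ((le_max_left _ _).trans hlog)
      ((le_max_right _ _).trans hlog) h est
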